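/- An instance of L-Sided Pricing is a finite bipartite graph $G=(L\cup R,E)$, parallel edges allowed, with capacities $\mu_v\in\mathbb Z_{\ge 0}\cup\{\infty\}$ for $v\in L\cup R$ and a budget $b_e\ge 0$ for each $e\in E$. A feasible solution is a pair $(p,F)$ of prices $p:L\cup R\to\mathbb R_{\ge 0}$ with $p(v)=0$ for all $v\in R$, and a set $F\subseteq E$ such that $p(u)+p(v)\le b_e$ for every $e=uv\in F$ and every $v\in L\cup R$ is an endpoint of at most $\mu_v$ edges of $F$. Its revenue is $\sum_{e=uv\in F}(p(u)+p(v))$; the goal is to maximize it. Let $\mathrm{val}(p)$ be the maximum revenue of a feasible solution with prices $p$. For $u\in L$ let $P_u=\{b_e : e \text{ is incident to } u\}$. A *pricing* is a price vector with $p(u)\in P_u$ for each $u\in L$ (and $p(u)=0$ if no edge is incident to $u$). For $\rho\ge 1$, a pricing $p$ is *locally optimal* for the $\rho$-swap local search if $\mathrm{val}(p')\le \mathrm{val}(p)$ for every pricing $p'$ that differs from $p$ in at most $\rho$ entries. **Theorem.** (a) Let $C\ge 2$ be real, $d\ge 0$ an integer and $\rho=\frac{C^{d+1}-1}{C-1}$.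 For every instance of L-Sided Pricing with $\mu_u\le C$ for all $u\in L$, the $\rho$-swap local search has locality gap at most $\frac{2C-1-C^{-d}}{C-C^{-d}}$: if $p$ is a locally optimal pricing and $p^*$ is any price vector (in particular an optimal one), then $$\mathrm{val}(p^*)\le \frac{2C-1-C^{-d}}{C-C^{-d}}\cdot \mathrm{val}(p).$$ (b) For all constants $C\ge 2$ and $\varepsilon>0$ there is a polynomial-time $\left(\frac{2C-1}{C}+\varepsilon\right)$-approximation for L-Sided Pricing on the instances with $\mu_u\le C$ for all $u\in L$ and rational budgets. That is, there is an algorithm which, on every such instance, computes in time polynomial in the bit length of the input a feasible solution $(p,F)$ with rational prices such that every feasible solution has revenue at most $\frac{2C-1}{C}+\varepsilon$ times that of $(p,F)$. -/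

import Mathlib

open scoped NNReal ENNReal NNRat

namespace Pricing

/-! ### The pricing problem -/

/-- An instance of L-Sided Pricing on a bipartite graph with sides `L`, `R` and edges (customers)
`E`; parallel edges are allowed. Budgets are nonnegative numbers of type `K` (`ℝ≥0`, or `ℚ≥0`
for an instance that is given to an algorithm), capacities are in `ℕ ∪ {∞}`. -/
structure Instance (K L R E : Type*) where
  left : E → L
  right : E → R
  budget : E → K
  capL : L → ℕ∞
  capR : R → ℕ∞

namespace Instance

variable {L R E : Type*}

/-- An instance with rational budgets, seen as an instance with real budgets. -/
def toReal (I : Instance ℚ≥0 L R E) : Instance ℝ≥0 L R E where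
  left := I.left
  right := I.right
  budget e := ((I.budget e : ℚ≥0) : ℝ≥0)
  capL := I.capL
  capR := I.capR

open Classical in
/-- `(p, F)` is a feasible solution. Every item of `R` has price `0`, so a customer `e` pays
`p (left e) + 0` for the bundle `{left e, right e}`. -/
structure Feasible (I : Instance ℝ≥0 L R E)
    (p : L → ℝ≥0) (F : Finset E) : Prop where
  afford : ∀ e ∈ F, p (I.left e) ≤ I.budget e
  supplyL : ∀ u : L, ((F.filter fun e => I.left e = u).card : ℕ∞) ≤ I.capL u
  supplyR : ∀ v : R, ((F.filter fun e => I.right e = v).card : ℕ∞) ≤ I.capR v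

/-- The revenue of selling to the customers in `F` at prices `p` (and `0` on `R`). -/
def revenue (I : Instance ℝ≥0 L R E) (p : L → ℝ≥0) (F : Finset E) : ℝ≥0 :=
  ∑ e ∈ F, p (I.left e)

open Classical in
/-- `val p`: the maximum revenue of a feasible solution with prices `p`
(the maximum is over a nonempty finite set, as `F = ∅` is feasible). -/
noncomputable def val [Fintype E] (I : Instance ℝ≥0 L R E) (p : L → ℝ≥0) : ℝ≥0 :=
  (Finset.univ.filter fun F : Finset E => I.Feasible p F).sup (I.revenue p)

/-- The price vectors that the local search works with: `p u` is the budget of some customer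
interested in `u` (and `0` if there is no such customer). -/
def IsPricing (I : Instance ℝ≥0 L R E) (p : L → ℝ≥0) : Prop :=
  ∀ u : L, (∃ e, I.left e = u ∧ p u = I.budget e) ∨ ((∀ e, I.left e ≠ u) ∧ p u = 0)

/-- `p` is a local optimum of the `ρ`-swap local search: no pricing that differs from `p` in at
most `ρ` entries has larger value. -/
def IsLocallyOptimal [Fintype L] [Fintype E] (I : Instance ℝ≥0 L R E) (ρ : ℝ)
    (p : L → ℝ≥0) : Prop :=
  I.IsPricing p ∧
    ∀ p' : L → ℝ≥0, I.IsPricing p' → (hammingDist p p' : ℝ) ≤ ρ → I.val p' ≤ I.val p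

/-- The locality gap with respect to the `ρ`-swap heuristic is at most `γ`: the value of any
prices whatsoever (in particular the optimum) is at most `γ` times that of any local optimum. -/
def LocalityGapAtMost [Fintype L] [Fintype E] (I : Instance ℝ≥0 L R E) (ρ γ : ℝ) : Prop :=
  ∀ p : L → ℝ≥0, I.IsLocallyOptimal ρ p → ∀ q : L → ℝ≥0, (I.val q : ℝ) ≤ γ * (I.val p : ℝ)

/-- Every capacity on the side `L` is at most `C`. -/
def CapBoundedBy {K : Type*} (I : Instance K L R E) (C : ℝ) : Prop :=
  ∀ u : L, ((I.capL u : ℕ∞) : ℝ≥0∞) ≤ ENNReal.ofReal C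

end Instance

/-! ### The machine model

A small while-language on binary trees with natural numbers at the leaves. The time of a run
charges every elementary instruction the full bit size of its argument and of its result, so a
Turing machine simulates a run with polynomial overhead, and conversely. -/

/-- Data: binary trees with natural numbers at the leaves. -/
inductive Data where
  | num (n : ℕ) : Data
  | pair (a b : Data) : Data

namespace Data

/-- Bit size; numbers are in binary. -/
def size : Data → ℕ
  | num n => 1 + Nat.size n
  | pair a b => 1 + a.size + b.size

/-- A list as data: nested pairs ending in `0`. -/
def ofList : List Data → Data
  | [] => num 0
  | a :: l => pair a (ofList l)

end Data

/-- The elementary instructions. -/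
inductive Op where
  | id
  | const (c : Data)
  | fst
  | snd
  | isPair
  | add
  | sub
  | mul
  | le

open Data in
/-- The effect of an elementary instruction; the result is `0` on data of the wrong shape.
Subtraction is truncated, tests return `1` for true and `0` for false. -/
def Op.apply : Op → Data → Data
  | .id, x => x
  | .const c, _ => c
  | .fst, pair a _ => a
  | .snd, pair _ b => b
  | .isPair, pair _ _ => num 1
  | .add, pair (num m) (num n) => num (m + n)
  | .sub, pair (num m) (num n) => num (m - n)
  | .mul, pair (num m) (num n) => num (m * n)
  | .le, pair (num m) (num n) => num (if m ≤ n then 1 else 0)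
  | _, _ => num 0

/-- Programs. -/
inductive Prog where
  | op (o : Op) : Prog
  /-- Run `p`, then `q` on the result. -/
  | seq (p q : Prog) : Prog
  /-- Run `p` and `q` on the input and pair the results. -/
  | fork (p q : Prog) : Prog
  /-- Run `p` on the input if the result of `c` on it is not `0`, otherwise `q`. -/
  | cond (c p q : Prog) : Prog
  /-- As long as the result of `c` on the current value is not `0`, apply `p` to the value. -/
  | loop (c p : Prog) : Prog

/-- `Runs P x y t`: the program `P` halts on input `x` with output `y` after time `t`. -/
inductive Prog.Runs : Prog → Data → Data → ℕ → Prop where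
  | op (o : Op) (x : Data) : Runs (.op o) x (o.apply x) (1 + x.size + (o.apply x).size)
  | seq {p q : Prog} {x y z : Data} {s t : ℕ} :
      Runs p x y s → Runs q y z t → Runs (.seq p q) x z (s + t + 1)
  | fork {p q : Prog} {x y z : Data} {s t : ℕ} :
      Runs p x y s → Runs q x z t → Runs (.fork p q) x (.pair y z) (s + t + 1)
  | cond_true {c p q : Prog} {x v y : Data} {s t : ℕ} :
      Runs c x v s → v ≠ .num 0 → Runs p x y t → Runs (.cond c p q) x y (s + t + 1)
  | cond_false {c p q : Prog} {x y : Data} {s t : ℕ} :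
      Runs c x (.num 0) s → Runs q x y t → Runs (.cond c p q) x y (s + t + 1)
  | loop_stop {c p : Prog} {x : Data} {s : ℕ} :
      Runs c x (.num 0) s → Runs (.loop c p) x x (s + 1)
  | loop_step {c p : Prog} {x v y z : Data} {s t r : ℕ} :
      Runs c x v s → v ≠ .num 0 → Runs p x y t → Runs (.loop c p) y z r →
        Runs (.loop c p) x z (s + t + r + 1)

/-! ### Input and output -/

/-- A capacity: `0` stands for `∞` and `n + 1` for `n`. -/
def encodeCap (c : ℕ∞) : Data := .num (if c = ⊤ then 0 else c.toNat + 1)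

/-- A nonnegative rational: numerator and denominator in lowest terms. -/
def encodeRat (x : ℚ≥0) : Data := .pair (.num x.num) (.num x.den)

/-- An instance: the list of capacities of `L`, the list of capacities of `R`, and the list of
customers, each with its two endpoints and its budget. -/
def Instance.encode {l r m : ℕ} (I : Instance ℚ≥0 (Fin l) (Fin r) (Fin m)) : Data :=
  .pair (.ofList (List.ofFn fun u => encodeCap (I.capL u)))
    (.pair (.ofList (List.ofFn fun v => encodeCap (I.capR v)))
      (.ofList (List.ofFn fun e => .pair (.pair (.num (I.left e)) (.num (I.right e)))
        (encodeRat (I.budget e)))))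

/-- A solution: the list of prices on `L`, and the `0`/`1` list of the customers in `F`. -/
def encodeSolution {l m : ℕ} (p : Fin l → ℚ≥0) (F : Finset (Fin m)) : Data :=
  .pair (.ofList (List.ofFn fun u => encodeRat (p u)))
    (.ofList (List.ofFn fun e => .num (if e ∈ F then 1 else 0)))

/-- There is a polynomial-time `α`-approximation for the instances of L-Sided Pricing in which all
capacities on the side `L` are at most `C`: a program that on every such instance halts, within
time polynomial in the bit size of the input, with a feasible solution whose revenue is at least
`1 / α` times that of every feasible solution. -/
def HasPolyTimeApprox (C α : ℝ) : Prop :=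
  ∃ (P : Prog) (T : Polynomial ℕ),
    ∀ (l r m : ℕ) (I : Instance ℚ≥0 (Fin l) (Fin r) (Fin m)), I.CapBoundedBy C →
      ∃ (p : Fin l → ℚ≥0) (F : Finset (Fin m)) (t : ℕ),
        P.Runs I.encode (encodeSolution p F) t ∧ t ≤ T.eval I.encode.size ∧
        I.toReal.Feasible (fun u => ((p u : ℚ≥0) : ℝ≥0)) F ∧
        ∀ (q : Fin l → ℝ≥0) (F' : Finset (Fin m)), I.toReal.Feasible q F' →
          (I.toReal.revenue q F' : ℝ) ≤
            α * (I.toReal.revenue (fun u => ((p u : ℚ≥0) : ℝ≥0)) F : ℝ)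

end Pricing

/-! Part (a). Let `F` be a best set for the locally optimal prices `p`, let `G` be one for the
competitor `q`, and let k = ⌊C⌋. At each item of R, pair edges of `G` with edges of `F` by rank. For
a set S of items of L, switch S to its `G`-edges and to the prices `q`, and drop the `F`-edges at S
together with those paired with an entering edge. The result is feasible (`exists_swap_matching`).

Each pair (g, f) is an arc from the left end of g to that of f, in a digraph on L with in- and
out-degrees at most k; fill it up to a k-regular digraph. Let m(u, w) be its number of walks of
length at most d from u to w, and ρ = 1 + k + ... + k^d. The swaps used are the level sets S(u, t) =
{w : t < m(u, w)} for 0 ≤ t < ρ. By regularity each has at most ρ members and each w lies in exactly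
ρ of them. An arc x → w has x inside and w outside at most k^d times, because a walk to x of length
below d extends along the arc to w (`exists_level_sets`). Over all swaps, an edge of `G` is thus
gained ρ times and an edge of `F` is lost at most ρ + k^d times. Since no swap improves, ρ · rev(G)
≤ (ρ + k^d) · rev(F) (`revenue_le_of_swaps`). The ratio 1 + k^d / ρ is monotone in k, and at k = C
it is the claimed gap (`gap_eq`).

Part (b). The algorithm searches over edge sets, each with its best prices `minPrice`, so that no
maximum-revenue subproblem has to be solved. A swap as above changes at most 3kρ edges, a constant,
so all neighbours can be listed. A move is accepted only if it multiplies the revenue by more than 1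
+ 1/M, where M = c|L| + 1; since a nonzero revenue v has polynomially many bits, there are
polynomially many moves. The improvements of at most v/M that are missed add at most |L|v/M ≤ (ε/2)v
to the bound, by `revenue_le_of_swaps` with slack δ, and a large d takes care of the other ε/2.
Closure rules for `PolyTime` turn the search into a program of the machine model. -/

namespace Pricing

/-! ### Regular matrices and their level sets -/

section Matrix

variable {L : Type*} [Fintype L] [DecidableEq L]

/-- A matrix of natural numbers with row and column sums at most `k` lies below one with all row
and column sums equal to `k`. -/
theorem exists_regular_ge (k : ℕ) (n : ℕ) : ∀ M : Matrix L L ℕ,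
    (∀ u, ∑ w, M u w ≤ k) → (∀ w, ∑ u, M u w ≤ k) → Fintype.card L * k ≤ (∑ u, ∑ w, M u w) + n →
    ∃ N : Matrix L L ℕ, (∀ u w, M u w ≤ N u w) ∧ (∀ u, ∑ w, N u w = k) ∧ ∀ w, ∑ u, N u w = k := by
  have key : ∀ M : Matrix L L ℕ, (∀ u, ∑ w, M u w ≤ k) →
      Fintype.card L * k ≤ (∑ u, ∑ w, M u w) → ∀ u, ∑ w, M u w = k := by
    intro M hr ht
    have h1 : ∑ u : L, k = Fintype.card L * k := by simp
    have h2 := (Finset.sum_eq_sum_iff_of_le (s := Finset.univ) (fun u _ => hr u)).1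
      (le_antisymm (Finset.sum_le_sum fun u _ => hr u) (by omega))
    exact fun u => h2 u (Finset.mem_univ u)
  induction n with
  | zero =>
    intro M hr hc ht
    refine ⟨M, fun _ _ => le_rfl, key M hr (by simpa using ht), ?_⟩
    refine key M.transpose hc ?_
    simp only [Matrix.transpose_apply]
    rw [Finset.sum_comm]
    simpa using ht
  | succ n ih =>
    intro M hr hc ht
    by_cases hall : Fintype.card L * k ≤ (∑ u, ∑ w, M u w) + n
    · exact ih M hr hc hall
    have h1 : ∑ u : L, k = Fintype.card L * k := by simp
    -- The total is below |L| · k, so some row and some column both have room; raising their common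
    -- entry by one reduces the deficit.
    obtain ⟨u, -, hu⟩ : ∃ u ∈ Finset.univ, ∑ w, M u w < k :=
      Finset.exists_lt_of_sum_lt (by omega)
    obtain ⟨w, -, hw⟩ : ∃ w ∈ Finset.univ, ∑ u, M u w < k :=
      Finset.exists_lt_of_sum_lt (by rw [Finset.sum_comm]; omega)
    have e1 : ∀ u', ∑ w', (M u' w' + if u' = u ∧ w' = w then 1 else 0) =
        (∑ w', M u' w') + if u' = u then 1 else 0 := by
      intro u'
      rw [Finset.sum_add_distrib]
      by_cases h : u' = u <;> simp [h]
    have e2 : ∀ w', ∑ u', (M u' w' + if u' = u ∧ w' = w then 1 else 0) =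
        (∑ u', M u' w') + if w' = w then 1 else 0 := by
      intro w'
      rw [Finset.sum_add_distrib]
      by_cases h : w' = w <;> simp [h]
    obtain ⟨N, hN, hN'⟩ := ih (fun u' w' => M u' w' + if u' = u ∧ w' = w then 1 else 0)
      (fun u' => by
        rw [e1]; have := hr u'
        split_ifs with h
        · subst h; omega
        · omega)
      (fun w' => by
        rw [e2]; have := hc w'
        split_ifs with h
        · subst h; omega
        · omega)
      (by
        simp only [e1, Finset.sum_add_distrib]
        simp
        omega)
    exact ⟨N, fun u' w' => le_trans (Nat.le_add_right _ _) (hN u' w'), hN'⟩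

/-- Entries of `N ^ j` count walks of length `j`, and every step of a walk has `k` choices. -/
theorem sum_pow_row {k : ℕ} {N : Matrix L L ℕ} (h : ∀ u, ∑ w, N u w = k) (j : ℕ) (u : L) :
    ∑ w, (N ^ j) u w = k ^ j := by
  induction j generalizing u with
  | zero => simp [Matrix.one_apply]
  | succ j ih =>
    simp only [pow_succ, Matrix.mul_apply]
    rw [Finset.sum_comm]
    simp only [← Finset.mul_sum, h, ← Finset.sum_mul, ih]

theorem sum_pow_col {k : ℕ} {N : Matrix L L ℕ} (h : ∀ w, ∑ u, N u w = k) (j : ℕ) (w : L) :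
    ∑ u, (N ^ j) u w = k ^ j := by
  have := sum_pow_row (N := N.transpose) (k := k) h j w
  simpa [← Matrix.transpose_pow] using this

/-- The level sets of the numbers of walks of length at most `d` in a `k`-regular digraph: they
cover every vertex equally often, and cut every arc at most `k ^ d` times. -/
theorem exists_level_sets {k : ℕ} (d : ℕ) {N : Matrix L L ℕ} {ρ : ℕ}
    (hρ : ρ = ∑ j ∈ Finset.range (d + 1), k ^ j) (hr : ∀ u, ∑ w, N u w = k)
    (hc : ∀ w, ∑ u, N u w = k) :
    ∃ S : L × Fin ρ → Finset L,
      (∀ i, (S i).card ≤ ρ) ∧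
      (∀ w, (Finset.univ.filter fun i => w ∈ S i).card = ρ) ∧
      ∀ x w, N x w ≠ 0 → (Finset.univ.filter fun i => x ∈ S i ∧ w ∉ S i).card ≤ k ^ d := by
  let m : L → L → ℕ := fun u w => ∑ j ∈ Finset.range (d + 1), (N ^ j) u w
  have hm1 : ∀ u, ∑ w, m u w = ρ := fun u => by
    simp only [m]; rw [Finset.sum_comm]; simp only [sum_pow_row hr, hρ]
  have hm2 : ∀ w, ∑ u, m u w = ρ := fun w => by
    simp only [m]; rw [Finset.sum_comm]; simp only [sum_pow_col hc, hρ]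
  have hmle : ∀ u w, m u w ≤ ρ := fun u w => by
    rw [← hm1 u]; exact Finset.single_le_sum (fun _ _ => Nat.zero_le _) (Finset.mem_univ w)
  have split : ∀ Q : L → ℕ → Prop, ∀ [∀ u t, Decidable (Q u t)],
      (Finset.univ.filter fun i : L × Fin ρ => Q i.1 i.2).card =
        ∑ u, ((Finset.range ρ).filter fun t => Q u t).card := by
    intro Q _
    rw [Finset.card_filter, Fintype.sum_prod_type]
    refine Finset.sum_congr rfl fun u _ => ?_
    rw [Finset.card_filter, ← Fin.sum_univ_eq_sum_range (fun t => if Q u t then 1 else 0)]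
  -- The index `(u, t)` stands for the level set of `m u` above height `t`; by `hmle` the heights
  -- below `ρ` exhaust every value.
  refine ⟨fun i => Finset.univ.filter fun w => (i.2 : ℕ) < m i.1 w, fun i => ?_, fun w => ?_,
    fun x w hxw => ?_⟩
  · refine le_of_le_of_eq ?_ (hm1 i.1)
    rw [Finset.card_filter]
    exact Finset.sum_le_sum fun w _ => by split_ifs <;> omega
  · simp only [Finset.mem_filter, Finset.mem_univ, true_and]
    rw [split fun u t => t < m u w]
    refine Eq.trans ?_ (hm2 w)
    refine Finset.sum_congr rfl fun u _ => ?_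
    have : ((Finset.range ρ).filter fun t => t < m u w) = Finset.range (m u w) := by
      ext t
      have := hmle u w
      simp only [Finset.mem_filter, Finset.mem_range]
      omega
    rw [this, Finset.card_range]
  · simp only [Finset.mem_filter, Finset.mem_univ, true_and]
    rw [split fun u t => t < m u x ∧ ¬ t < m u w, ← sum_pow_col hc d x]
    refine Finset.sum_le_sum fun u _ => ?_
    -- Walks from `u` to `x` of length below `d` extend along the arc to walks to `w` of length
    -- between 1 and `d`; only the walks of length exactly `d` are left over.
    have h1 : m u x ≤ m u w + (N ^ d) u x := by
      simp only [m]
      rw [Finset.sum_range_succ, Finset.sum_range_succ' (fun j => (N ^ j) u w)]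
      have : ∑ j ∈ Finset.range d, (N ^ j) u x ≤ ∑ j ∈ Finset.range d, (N ^ (j + 1)) u w := by
        refine Finset.sum_le_sum fun j _ => ?_
        rw [pow_succ, Matrix.mul_apply]
        calc (N ^ j) u x ≤ (N ^ j) u x * N x w := Nat.le_mul_of_pos_right _ (Nat.pos_of_ne_zero hxw)
          _ ≤ _ := Finset.single_le_sum (f := fun y => (N ^ j) u y * N y w)
              (fun _ _ => Nat.zero_le _) (Finset.mem_univ x)
      omega
    calc _ ≤ (Finset.Ico (m u w) (m u x)).card := Finset.card_le_card fun t => by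
            simp only [Finset.mem_filter, Finset.mem_range, Finset.mem_Ico]; omega
      _ ≤ _ := by rw [Nat.card_Ico]; omega

end Matrix

/-! ### Swaps -/

/-- The ranks of the edges at an item of R serve twice: they define the matching, and they bound the
degree after a swap. -/
theorem exists_rank {E : Type*} (A : Finset E) :
    ∃ r : E → ℕ, Set.InjOn r A ∧ ∀ e ∈ A, r e < A.card := by
  classical
  refine ⟨fun e => if h : e ∈ A then (A.equivFin ⟨e, h⟩ : ℕ) else 0, fun e he f hf h => ?_,
    fun e he => ?_⟩
  · have he' : e ∈ A := he
    have hf' : f ∈ A := hf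
    simp only [he', hf', dif_pos] at h
    simpa using A.equivFin.injective (Fin.ext h)
  · simp only [he, dif_pos]
    exact (A.equivFin ⟨e, he⟩).2

open Classical in
/-- The edges that replace `F` when the vertices of `S` switch to the solution `G`; `Mt` tells which
edge of `F` has to leave for an edge of `G`. -/
noncomputable def swapEdges {L E : Type*} (left : E → L) (Mt : E → E → Prop) (F G : Finset E)
    (S : Finset L) : Finset E :=
  (G.filter fun g => left g ∈ S) ∪
    (F.filter fun f => left f ∉ S ∧ ∀ g ∈ G, left g ∈ S → ¬ Mt g f)

namespace Instance

variable {L R E : Type*}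

open Classical in
theorem card_filter_left_mem_le (I : Instance ℝ≥0 L R E) {k : ℕ} {F : Finset E}
    (h : ∀ u, (F.filter fun e => I.left e = u).card ≤ k) (S : Finset L) :
    (F.filter fun e => I.left e ∈ S).card ≤ k * S.card := by
  refine Finset.card_le_mul_card_image_of_maps_to (f := I.left)
    (fun e he => (Finset.mem_filter.1 he).2) k fun u _ => ?_
  refine le_trans (Finset.card_le_card fun e => ?_) (h u)
  simp only [Finset.mem_filter]
  tauto

open Classical in
/-- A matching between the edges of two solutions for which all swaps are feasible. -/
theorem exists_swap_matching (I : Instance ℝ≥0 L R E) {p q : L → ℝ≥0} {F G : Finset E}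
    (hF : I.Feasible p F) (hG : I.Feasible q G) :
    ∃ Mt : E → E → Prop,
      (∀ g ∈ G, ∀ g' ∈ G, ∀ f ∈ F, Mt g f → Mt g' f → g = g') ∧
      (∀ g ∈ G, ∀ f ∈ F, ∀ f' ∈ F, Mt g f → Mt g f' → f = f') ∧
      ∀ S : Finset L, I.Feasible (S.piecewise q p) (swapEdges I.left Mt F G S) := by
  choose rF hF1 hF2 using fun v => exists_rank (F.filter fun e => I.right e = v)
  choose rG hG1 hG2 using fun v => exists_rank (G.filter fun e => I.right e = v)
  have iF : ∀ f ∈ F, ∀ f' ∈ F, I.right f = I.right f' →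
      rF (I.right f) f = rF (I.right f') f' → f = f' := fun f hf f' hf' h h' =>
    hF1 (I.right f) (by simp [hf]) (by simp [hf', h]) (by rw [h'] ; rw [h])
  have iG : ∀ f ∈ G, ∀ f' ∈ G, I.right f = I.right f' →
      rG (I.right f) f = rG (I.right f') f' → f = f' := fun f hf f' hf' h h' =>
    hG1 (I.right f) (by simp [hf]) (by simp [hf', h]) (by rw [h'] ; rw [h])
  obtain ⟨Mt, hMt⟩ : ∃ Mt : E → E → Prop, ∀ g f, Mt g f ↔
    I.right g = I.right f ∧ rG (I.right g) g = rF (I.right f) f := ⟨_, fun _ _ => Iff.rfl⟩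
  refine ⟨Mt, fun g hg g' hg' f hf h h' => ?_, fun g hg f hf f' hf' h h' => ?_, fun S => ⟨fun e he => ?_, fun u => ?_, fun v => ?_⟩⟩
  · rw [hMt] at h h'
    exact iG g hg g' hg' (h.1.trans h'.1.symm) (h.2.trans h'.2.symm)
  · rw [hMt] at h h'
    exact iF f hf f' hf' (h.1.symm.trans h'.1) (h.2.symm.trans h'.2)
  · rcases Finset.mem_union.1 he with h | h <;> rw [Finset.mem_filter] at h
    · rw [Finset.piecewise_eq_of_mem _ _ _ h.2]; exact hG.afford e h.1
    · rw [Finset.piecewise_eq_of_notMem _ _ _ h.2.1]; exact hF.afford e h.1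
  · by_cases hu : u ∈ S
    · refine le_trans (Nat.cast_le.2 (Finset.card_le_card fun e he => ?_)) (hG.supplyL u)
      simp only [swapEdges, Finset.mem_filter, Finset.mem_union] at he ⊢
      rcases he with ⟨h | h, rfl⟩
      · exact ⟨h.1, rfl⟩
      · exact absurd hu h.2.1
    · refine le_trans (Nat.cast_le.2 (Finset.card_le_card fun e he => ?_)) (hF.supplyL u)
      simp only [swapEdges, Finset.mem_filter, Finset.mem_union] at he ⊢
      rcases he with ⟨h | h, rfl⟩
      · exact absurd h.2 hu
      · exact ⟨h.1, rfl⟩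
  · have hmax : ((max (F.filter fun e => I.right e = v).card
        (G.filter fun e => I.right e = v).card : ℕ) : ℕ∞) ≤ I.capR v := by
      rcases max_choice (F.filter fun e => I.right e = v).card
        (G.filter fun e => I.right e = v).card with h | h <;> rw [h]
      exacts [hF.supplyR v, hG.supplyR v]
    refine le_trans (Nat.cast_le.2 ?_) hmax
    -- Label an edge at `v` by its rank in `G` if it enters, and by its rank in `F` otherwise. An
    -- entering and a remaining edge with equal labels would be matched, but then the `F`-edge has
    -- left. So the labels are distinct, and they lie below the larger of the two degrees.
    rw [← Finset.card_range (max _ _)]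
    refine Finset.card_le_card_of_injOn
      (fun e => if e ∈ G ∧ I.left e ∈ S then rG (I.right e) e else rF (I.right e) e)
      (fun e he => ?_) fun e he e' he' h => ?_
    · simp only [swapEdges, Finset.coe_filter, Set.mem_ofPred_eq, Finset.mem_union,
        Finset.mem_filter] at he
      simp only [Finset.coe_range, Set.mem_Iio, lt_max_iff]
      obtain ⟨h, rfl⟩ := he
      split_ifs with hc
      · exact Or.inr (hG2 _ e (by simp [hc.1]))
      · exact Or.inl (hF2 _ e (by simp [(h.resolve_left hc).1]))
    · simp only [swapEdges, Finset.coe_filter, Set.mem_ofPred_eq, Finset.mem_union,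
        Finset.mem_filter] at he he'
      obtain ⟨h1, h2⟩ := he
      obtain ⟨h1', h2'⟩ := he'
      have hr : I.right e = I.right e' := h2.trans h2'.symm
      by_cases hc : e ∈ G ∧ I.left e ∈ S <;> by_cases hc' : e' ∈ G ∧ I.left e' ∈ S
      · simp only [if_pos hc, if_pos hc'] at h
        exact iG e hc.1 e' hc'.1 hr h
      · simp only [if_pos hc, if_neg hc'] at h
        exact absurd ((hMt _ _).2 ⟨hr, h⟩) ((h1'.resolve_left hc').2.2 e hc.1 hc.2)
      · simp only [if_neg hc, if_pos hc'] at h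
        exact absurd ((hMt _ _).2 ⟨hr.symm, h.symm⟩) ((h1.resolve_left hc).2.2 e' hc'.1 hc'.2)
      · simp only [if_neg hc, if_neg hc'] at h
        exact iF e (h1.resolve_left hc).1 e' (h1'.resolve_left hc').1 hr h

-- The three terms are the `F`-edges at `S`, the `G`-edges at `S`, and the `F`-edges displaced by
-- the latter, at most one each.
open Classical in
theorem card_symmDiff_swapEdges_le (I : Instance ℝ≥0 L R E) {k : ℕ} {F G : Finset E}
    {Mt : E → E → Prop} (hMt : ∀ g ∈ G, ∀ f ∈ F, ∀ f' ∈ F, Mt g f → Mt g f' → f = f')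
    (hF : ∀ u, (F.filter fun e => I.left e = u).card ≤ k)
    (hG : ∀ u, (G.filter fun e => I.left e = u).card ≤ k) (S : Finset L) :
    (symmDiff F (swapEdges I.left Mt F G S)).card ≤ 3 * (k * S.card) := by
  have h1 := I.card_filter_left_mem_le hF S
  have h2 := I.card_filter_left_mem_le hG S
  have h3 : ((G.filter fun e => I.left e ∈ S).biUnion fun g => F.filter fun f => Mt g f).card ≤
      (G.filter fun e => I.left e ∈ S).card * 1 := by
    refine Finset.card_biUnion_le_card_mul _ _ _ fun g hg => Finset.card_le_one.2 ?_
    intro f hf f' hf'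
    rw [Finset.mem_filter] at hg hf hf'
    exact hMt g hg.1 f hf.1 f' hf'.1 hf.2 hf'.2
  refine le_trans (Finset.card_le_card (t := ((F.filter fun e => I.left e ∈ S) ∪
    (G.filter fun e => I.left e ∈ S)) ∪
    ((G.filter fun e => I.left e ∈ S).biUnion fun g => F.filter fun f => Mt g f)) fun e he => ?_) ?_
  · simp only [swapEdges, Finset.mem_symmDiff, Finset.mem_union, Finset.mem_filter,
      Finset.mem_biUnion] at he ⊢
    by_cases h : ∃ g ∈ G, I.left g ∈ S ∧ Mt g e
    · obtain ⟨g, hg, hg', hg''⟩ := h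
      by_cases heF : e ∈ F
      · exact Or.inr ⟨g, ⟨hg, hg'⟩, heF, hg''⟩
      · left; tauto
    · push Not at h
      by_cases heF : e ∈ F <;> tauto
  · refine le_trans (Finset.card_union_le _ _) ?_
    have := Finset.card_union_le (F.filter fun e => I.left e ∈ S) (G.filter fun e => I.left e ∈ S)
    omega

open Classical in
theorem revenue_swapEdges (I : Instance ℝ≥0 L R E) (p q : L → ℝ≥0) (F G : Finset E)
    (Mt : E → E → Prop) (S : Finset L) :
    (I.revenue (S.piecewise q p) (swapEdges I.left Mt F G S) : ℝ) =
      ∑ g ∈ G, (if I.left g ∈ S then (q (I.left g) : ℝ) else 0) +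
        ∑ f ∈ F, if I.left f ∉ S ∧ ∀ g ∈ G, I.left g ∈ S → ¬ Mt g f
          then (p (I.left f) : ℝ) else 0 := by
  rw [revenue, swapEdges, Finset.sum_union, NNReal.coe_add, NNReal.coe_sum, NNReal.coe_sum,
    Finset.sum_filter, Finset.sum_filter]
  · congr 1
    · refine Finset.sum_congr rfl fun g _ => ?_
      split_ifs with h
      · rw [Finset.piecewise_eq_of_mem _ _ _ h]
      · rfl
    · refine Finset.sum_congr rfl fun f _ => ?_
      split_ifs with h
      · rw [Finset.piecewise_eq_of_notMem _ _ _ h.1]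
      · rfl
  · rw [Finset.disjoint_left]
    intro e h h'
    exact (Finset.mem_filter.1 h').2.1 (Finset.mem_filter.1 h).2

open Classical in
/-- If no swap of few vertices improves `F` by more than `δ`, then `F` is not much worse than `G`. -/
theorem revenue_le_of_swaps [Fintype L] (I : Instance ℝ≥0 L R E) {k d ρ : ℕ}
    (hρ : ρ = ∑ j ∈ Finset.range (d + 1), k ^ j) {p q : L → ℝ≥0}
    {F G : Finset E} (hcap : ∀ u, I.capL u ≤ k) (hF : I.Feasible p F) (hG : I.Feasible q G) (δ : ℝ)
    (h : ∀ (S : Finset L) (F' : Finset E), S.card ≤ ρ →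
      I.Feasible (S.piecewise q p) F' →
      (symmDiff F F').card ≤ 3 * (k * ρ) →
      (I.revenue (S.piecewise q p) F' : ℝ) ≤ I.revenue p F + δ) :
    (ρ : ℝ) * I.revenue q G ≤
      ((ρ : ℝ) + (k : ℝ) ^ d) * I.revenue p F +
        (ρ : ℝ) * (Fintype.card L * δ) := by
  obtain ⟨Mt, hM1, hM2, hM3⟩ := I.exists_swap_matching hF hG
  have cF : ∀ u, (F.filter fun e => I.left e = u).card ≤ k := fun u =>
    Nat.cast_le.1 ((hF.supplyL u).trans (hcap u))
  have cG : ∀ u, (G.filter fun e => I.left e = u).card ≤ k := fun u =>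
    Nat.cast_le.1 ((hG.supplyL u).trans (hcap u))
  let W := (G ×ˢ F).filter fun x => Mt x.1 x.2
  -- The displacement digraph: an arc from `u` to `w` means that switching `u` to `G` costs `w` an
  -- edge of `F`.
  let M : Matrix L L ℕ := fun u w =>
    ((W.filter fun x => I.left x.1 = u).filter fun x => I.left x.2 = w).card
  have hMr : ∀ u, ∑ w, M u w ≤ k := by
    intro u
    have hs : ∑ w, M u w = (W.filter fun x => I.left x.1 = u).card := by
      convert (Finset.card_eq_sum_card_fiberwise (f := fun x : E × E => I.left x.2)
        (fun _ _ => Finset.mem_coe.2 (Finset.mem_univ _))).symm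
    rw [hs]
    refine le_trans (Finset.card_le_card_of_injOn Prod.fst (fun x hx => ?_) ?_) (cG u)
    · simp [W] at hx ⊢; tauto
    · rintro ⟨g, f⟩ hx ⟨g', f'⟩ hx' (rfl : g = g')
      simp [W] at hx hx'
      rw [hM2 g hx.1.1.1 f hx.1.1.2 f' hx'.1.1.2 hx.1.2 hx'.1.2]
  have hMc : ∀ w, ∑ u, M u w ≤ k := by
    intro w
    have hs : ∑ u, M u w = (W.filter fun x => I.left x.2 = w).card := by
      simp only [M, Finset.filter_comm]
      convert (Finset.card_eq_sum_card_fiberwise (f := fun x : E × E => I.left x.1)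
        (fun _ _ => Finset.mem_coe.2 (Finset.mem_univ _))).symm
    rw [hs]
    refine le_trans (Finset.card_le_card_of_injOn Prod.snd (fun x hx => ?_) ?_) (cF w)
    · simp [W] at hx ⊢; tauto
    · rintro ⟨g, f⟩ hx ⟨g', f'⟩ hx' (rfl : f = f')
      simp [W] at hx hx'
      rw [hM1 g hx.1.1.1 g' hx'.1.1.1 f hx.1.1.2 hx.1.2 hx'.1.2]
  obtain ⟨N, hN1, hN2, hN3⟩ := exists_regular_ge k _ M hMr hMc (Nat.le_add_left _ _)
  obtain ⟨S, hS1, hS2, hS3⟩ := exists_level_sets d hρ hN2 hN3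
  have main : ∀ i, ∑ g ∈ G, (if I.left g ∈ S i then (q (I.left g) : ℝ) else 0) +
        (∑ f ∈ F, if I.left f ∉ S i ∧ ∀ g ∈ G, I.left g ∈ S i → ¬ Mt g f
          then (p (I.left f) : ℝ) else 0) ≤ I.revenue p F + δ := by
    intro i
    rw [← revenue_swapEdges]
    refine h _ _ (hS1 i) (hM3 _) ((I.card_symmDiff_swapEdges_le hM2 cF cG _).trans ?_)
    have := Nat.mul_le_mul_left k (hS1 i)
    omega
  -- An edge `f` is lost when its own left end switches, which happens `ρ` times, or when only the
  -- left end of its partner does. In the latter case the arc between them is cut, which happens at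
  -- most `k ^ d` times.
  have keep : ∀ f ∈ F, Fintype.card (L × Fin ρ) ≤ (Finset.univ.filter fun i =>
      I.left f ∉ S i ∧ ∀ g ∈ G, I.left g ∈ S i → ¬ Mt g f).card + (ρ + k ^ d) := by
    intro f hf
    have h1 : (Finset.univ.filter fun i => I.left f ∉ S i ∧
        ∃ g ∈ G, I.left g ∈ S i ∧ Mt g f).card ≤ k ^ d := by
      by_cases hg : ∃ g ∈ G, Mt g f
      · obtain ⟨g, hg, hgf⟩ := hg
        refine le_trans (Finset.card_le_card fun i hi => ?_) (hS3 (I.left g) (I.left f) ?_)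
        · simp only [Finset.mem_filter, Finset.mem_univ, true_and] at hi ⊢
          obtain ⟨hi, g', hg', hi', hg'f⟩ := hi
          rw [hM1 g hg g' hg' f hf hgf hg'f]
          exact ⟨hi', hi⟩
        · refine Nat.pos_iff_ne_zero.1 (lt_of_lt_of_le (Finset.card_pos.2 ⟨(g, f), ?_⟩) (hN1 _ _))
          simp [W, hg, hf, hgf]
      · rw [Finset.filter_false_of_mem]
        · simp
        · rintro i - ⟨-, g, hg', -, hg''⟩
          exact hg ⟨g, hg', hg''⟩
    have h2 := hS2 (I.left f)
    have h3 : Fintype.card (L × Fin ρ) ≤ (Finset.univ.filter fun i =>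
        I.left f ∉ S i ∧ ∀ g ∈ G, I.left g ∈ S i → ¬ Mt g f).card +
        ((Finset.univ.filter fun i => I.left f ∈ S i).card +
        (Finset.univ.filter fun i => I.left f ∉ S i ∧ ∃ g ∈ G, I.left g ∈ S i ∧ Mt g f).card) := by
      rw [← Finset.card_univ]
      refine le_trans (Finset.card_le_card fun i _ => ?_) ((Finset.card_union_le _ _).trans
        (Nat.add_le_add_left (Finset.card_union_le _ _) _))
      simp only [Finset.mem_union, Finset.mem_filter, Finset.mem_univ, true_and]
      by_cases h : ∃ g ∈ G, I.left g ∈ S i ∧ Mt g f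
      · tauto
      · push Not at h; tauto
    omega
  -- Sum over all |L| · `ρ` swaps. The |L| · `ρ` copies of the revenue of `F` cancel, which leaves
  -- the gains against the losses and the slack.
  have total := Finset.sum_le_sum fun i (_ : i ∈ Finset.univ) => main i
  rw [Finset.sum_add_distrib, Finset.sum_comm, Finset.sum_comm (t := F), Finset.sum_const,
    Finset.card_univ, nsmul_eq_mul] at total
  have e1 : ∑ g ∈ G, ∑ i, (if I.left g ∈ S i then (q (I.left g) : ℝ) else 0) =
      ρ * I.revenue q G := by
    rw [revenue, NNReal.coe_sum, Finset.mul_sum]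
    refine Finset.sum_congr rfl fun g _ => ?_
    rw [← Finset.sum_filter, Finset.sum_const, hS2, nsmul_eq_mul]
  have e2 : ((Fintype.card (L × Fin ρ) : ℝ) - (ρ + (k : ℝ) ^ d)) * I.revenue p F ≤
      ∑ f ∈ F, ∑ i, (if I.left f ∉ S i ∧ ∀ g ∈ G, I.left g ∈ S i → ¬ Mt g f
          then (p (I.left f) : ℝ) else 0) := by
    rw [revenue, NNReal.coe_sum, Finset.mul_sum]
    refine Finset.sum_le_sum fun f hf => ?_
    rw [← Finset.sum_filter, Finset.sum_const, nsmul_eq_mul]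
    refine mul_le_mul_of_nonneg_right ?_ (NNReal.coe_nonneg _)
    have : ((Fintype.card (L × Fin ρ) : ℕ) : ℝ) ≤ ((_ : ℕ) : ℝ) := Nat.cast_le.2 (keep f hf)
    push_cast at this ⊢
    linarith
  have e3 : (Fintype.card (L × Fin ρ) : ℝ) = Fintype.card L * ρ := by
    simp [Fintype.card_prod]
  rw [e1] at total
  rw [e3] at total e2
  nlinarith [total, e2]

end Instance

namespace Instance

/-! ### The locality gap -/

variable {L R E : Type*}

open Classical in
/-- The best prices for selling to `F`. -/
noncomputable def minPrice (I : Instance ℝ≥0 L R E) (F : Finset E) (u : L) : ℝ≥0 :=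
  if h : (F.filter fun e => I.left e = u).Nonempty then
    (F.filter fun e => I.left e = u).inf' h I.budget else 0

theorem minPrice_le (I : Instance ℝ≥0 L R E) {F : Finset E} {e : E} (he : e ∈ F) :
    I.minPrice F (I.left e) ≤ I.budget e := by
  classical
  have h : e ∈ F.filter fun e' => I.left e' = I.left e := by simp [he]
  rw [minPrice, dif_pos ⟨e, h⟩]
  exact Finset.inf'_le _ h

theorem exists_minPrice_eq (I : Instance ℝ≥0 L R E) {F : Finset E} {e : E} (he : e ∈ F) :
    ∃ f ∈ F, I.left f = I.left e ∧ I.minPrice F (I.left e) = I.budget f := by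
  classical
  have h : e ∈ F.filter fun e' => I.left e' = I.left e := by simp [he]
  obtain ⟨f, hf, hf'⟩ := Finset.exists_mem_eq_inf' ⟨e, h⟩ I.budget
  rw [Finset.mem_filter] at hf
  exact ⟨f, hf.1, hf.2, by rw [minPrice, dif_pos ⟨e, h⟩, hf']⟩

theorem minPrice_eq_zero (I : Instance ℝ≥0 L R E) {F : Finset E} {u : L}
    (h : ∀ e ∈ F, I.left e ≠ u) : I.minPrice F u = 0 := by
  classical
  refine dif_neg ?_
  rintro ⟨e, he⟩
  rw [Finset.mem_filter] at he
  exact h e he.1 he.2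

theorem le_minPrice (I : Instance ℝ≥0 L R E) {F : Finset E} {q : L → ℝ≥0}
    (h : ∀ e ∈ F, q (I.left e) ≤ I.budget e) {e : E} (he : e ∈ F) :
    q (I.left e) ≤ I.minPrice F (I.left e) := by
  obtain ⟨f, hf, hf', hf''⟩ := I.exists_minPrice_eq he
  rw [hf'', ← hf']
  exact h f hf

theorem Feasible.revenue_le {I : Instance ℝ≥0 L R E} {F : Finset E} {q : L → ℝ≥0}
    (h : I.Feasible q F) : I.revenue q F ≤ I.revenue (I.minPrice F) F :=
  Finset.sum_le_sum fun _ he => I.le_minPrice h.afford he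

theorem Feasible.minPrice {I : Instance ℝ≥0 L R E} {F : Finset E} {q : L → ℝ≥0}
    (h : I.Feasible q F) : I.Feasible (I.minPrice F) F :=
  ⟨fun _ he => I.minPrice_le he, h.supplyL, h.supplyR⟩

/-- An item with no edge in `F` still needs one of its budgets as price; any of them will do, since
neither feasibility nor revenue of `F` sees it. -/
theorem Feasible.exists_pricing {I : Instance ℝ≥0 L R E} {F : Finset E} {q : L → ℝ≥0}
    (h : I.Feasible q F) :
    ∃ q', I.IsPricing q' ∧ I.Feasible q' F ∧ I.revenue q F ≤ I.revenue q' F := by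
  classical
  let q' : L → ℝ≥0 := fun u => if (F.filter fun e => I.left e = u).Nonempty then I.minPrice F u
    else if h : ∃ e, I.left e = u then I.budget h.choose else 0
  have hq : ∀ e ∈ F, q' (I.left e) = I.minPrice F (I.left e) := fun e he =>
    if_pos ⟨e, by simp [he]⟩
  refine ⟨q', fun u => ?_, ⟨fun e he => ?_, h.supplyL, h.supplyR⟩, ?_⟩
  · by_cases h1 : (F.filter fun e => I.left e = u).Nonempty
    · obtain ⟨e, he⟩ := id h1
      obtain ⟨heF, rfl⟩ := Finset.mem_filter.1 he
      obtain ⟨f, -, hf, hf'⟩ := I.exists_minPrice_eq heF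
      exact Or.inl ⟨f, hf, (hq e heF).trans hf'⟩
    · by_cases h2 : ∃ e, I.left e = u
      · exact Or.inl ⟨h2.choose, h2.choose_spec, by simp only [q', if_neg h1, dif_pos h2]⟩
      · exact Or.inr ⟨fun e he => h2 ⟨e, he⟩, by simp only [q', if_neg h1, dif_neg h2]⟩
  · rw [hq e he]; exact I.minPrice_le he
  · refine h.revenue_le.trans (le_of_eq ?_)
    exact Finset.sum_congr rfl fun e he => (hq e he).symm

theorem feasible_empty (I : Instance ℝ≥0 L R E) (p : L → ℝ≥0) : I.Feasible p ∅ :=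
  ⟨by simp, by simp, by simp⟩

theorem exists_val_eq [Fintype E] (I : Instance ℝ≥0 L R E) (p : L → ℝ≥0) :
    ∃ F, I.Feasible p F ∧ I.val p = I.revenue p F := by
  classical
  obtain ⟨F, hF, h⟩ := Finset.exists_mem_eq_sup
    (Finset.univ.filter fun F : Finset E => I.Feasible p F)
    ⟨∅, by simpa using I.feasible_empty p⟩ (I.revenue p)
  refine ⟨F, (Finset.mem_filter.1 hF).2, ?_⟩
  rw [← h, val]

theorem Feasible.revenue_le_val [Fintype E] {I : Instance ℝ≥0 L R E} {p : L → ℝ≥0} {F : Finset E}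
    (h : I.Feasible p F) : I.revenue p F ≤ I.val p := by
  classical
  exact Finset.le_sup (f := I.revenue p) (by simpa using h)

theorem capL_le_floor {K : Type*} {I : Instance K L R E} {C : ℝ} (h : I.CapBoundedBy C) (hC : 0 ≤ C)
    (u : L) : I.capL u ≤ (⌊C⌋₊ : ℕ) := by
  have h1 := h u
  have h2 : I.capL u ≠ ⊤ := by
    intro h3
    rw [h3] at h1
    simp at h1
  lift I.capL u to ℕ using h2 with n
  rw [Nat.cast_le, Nat.le_floor_iff hC]
  have h1 : (n : ℝ≥0∞) ≤ ENNReal.ofReal C := by simpa using h1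
  rw [← ENNReal.ofReal_natCast] at h1
  exact (ENNReal.ofReal_le_ofReal_iff hC).1 h1

end Instance

/-! ### The ratio of k^d to 1 + k + ... + k^d -/

/-- Termwise, a^d b^j ≤ b^d a^j for j ≤ d. With a = ⌊C⌋ and b = C this passes from the integral
capacity bound to the real one. -/
theorem pow_mul_geom_sum_le {a b : ℝ} (ha : 0 ≤ a) (hab : a ≤ b) (d : ℕ) :
    a ^ d * ∑ j ∈ Finset.range (d + 1), b ^ j ≤ b ^ d * ∑ j ∈ Finset.range (d + 1), a ^ j := by
  rw [Finset.mul_sum, Finset.mul_sum]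
  refine Finset.sum_le_sum fun j hj => ?_
  obtain ⟨i, rfl⟩ := Nat.exists_eq_add_of_le (Nat.lt_succ_iff.1 (Finset.mem_range.1 hj))
  have : a ^ i ≤ b ^ i := pow_le_pow_left₀ ha hab i
  have h2 : 0 ≤ a ^ j * b ^ j := mul_nonneg (pow_nonneg ha j) (pow_nonneg (ha.trans hab) j)
  rw [pow_add, pow_add]
  nlinarith [mul_le_mul_of_nonneg_left this h2]

theorem geom_sum_pos_of_nonneg {a : ℝ} (ha : 0 ≤ a) (d : ℕ) :
    0 < ∑ j ∈ Finset.range (d + 1), a ^ j := by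
  rw [Finset.sum_range_succ']
  have : 0 ≤ ∑ j ∈ Finset.range d, a ^ (j + 1) := Finset.sum_nonneg fun _ _ => by positivity
  simp; linarith

theorem pow_le_geom_sum_mul {a b : ℝ} (ha : 0 ≤ a) (hab : a ≤ b) (d : ℕ) :
    a ^ d ≤ (∑ j ∈ Finset.range (d + 1), a ^ j) *
      (b ^ d / ∑ j ∈ Finset.range (d + 1), b ^ j) := by
  rw [← mul_div_assoc, le_div_iff₀ (geom_sum_pos_of_nonneg (ha.trans hab) d)]
  linarith [pow_mul_geom_sum_le ha hab d]

/-- The locality gap, for depth `d` and branching `C`. -/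
theorem gap_eq {C : ℝ} (hC : 2 ≤ C) (d : ℕ) :
    (2 * C - 1 - C ^ (-(d : ℤ))) / (C - C ^ (-(d : ℤ))) =
      1 + C ^ d / ∑ j ∈ Finset.range (d + 1), C ^ j := by
  have h0 : 0 < C ^ d := by positivity
  have h1 : 1 < C ^ (d + 1) := one_lt_pow₀ (by linarith) (by omega)
  rw [geom_sum_eq (by linarith), zpow_neg, zpow_natCast]
  have h2 : C - (C ^ d)⁻¹ ≠ 0 := by
    intro h
    have : C ^ (d + 1) = 1 := by
      have := congrArg (· * C ^ d) h
      simp only [sub_mul, inv_mul_cancel₀ h0.ne'] at this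
      rw [pow_succ]; linarith
    linarith
  have h3 : C ^ (d + 1) - 1 ≠ 0 := by linarith
  have h4 : C - 1 ≠ 0 := by linarith
  field_simp
  have h5 : C * C ^ d - 1 ≠ 0 := by rw [← pow_succ']; exact h3
  rw [pow_succ'] at *
  field_simp
  ring

namespace Instance

variable {L R E : Type*}

theorem localityGapAtMost [Fintype L] [Fintype E] (I : Instance ℝ≥0 L R E) {C : ℝ} (d : ℕ)
    (hC : 2 ≤ C) (hI : I.CapBoundedBy C) :
    I.LocalityGapAtMost ((C ^ (d + 1) - 1) / (C - 1))
      ((2 * C - 1 - C ^ (-(d : ℤ))) / (C - C ^ (-(d : ℤ)))) := by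
  classical
  intro p hp q
  obtain ⟨F, hF, hpF⟩ := I.exists_val_eq p
  obtain ⟨G, hG, hqG⟩ := I.exists_val_eq q
  obtain ⟨q', hq', hG', hle⟩ := hG.exists_pricing
  have hk : (⌊C⌋₊ : ℝ) ≤ C := Nat.floor_le (by linarith)
  -- A mixture of two pricings is a pricing, so local optimality gives slack 0. The swap size
  -- obtained from ⌊C⌋ is at most the radius for C.
  have key := I.revenue_le_of_swaps (d := d) rfl
    (capL_le_floor hI (by linarith)) hF hG' 0 (fun S F' hS hF' _ => by
      rw [add_zero, ← hpF, NNReal.coe_le_coe]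
      refine hF'.revenue_le_val.trans (hp.2 _ (fun u => ?_) ?_)
      · by_cases hu : u ∈ S
        · rw [Finset.piecewise_eq_of_mem _ _ _ hu]; exact hq' u
        · rw [Finset.piecewise_eq_of_notMem _ _ _ hu]; exact hp.1 u
      · rw [← geom_sum_eq (by linarith)]
        have h1 : hammingDist p (S.piecewise q' p) ≤ S.card := by
          refine Finset.card_le_card fun u hu => ?_
          by_contra hu'
          simp [hu'] at hu
        calc (hammingDist p (S.piecewise q' p) : ℝ) ≤
            ((∑ j ∈ Finset.range (d + 1), ⌊C⌋₊ ^ j : ℕ) : ℝ) := Nat.cast_le.2 (h1.trans hS)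
          _ ≤ _ := by
            push_cast
            exact Finset.sum_le_sum fun j _ => pow_le_pow_left₀ (by positivity) hk j)
  rw [mul_zero, mul_zero, add_zero, ← hpF] at key
  push_cast at key
  rw [gap_eq hC, hqG]
  have h2 := geom_sum_pos_of_nonneg (Nat.cast_nonneg ⌊C⌋₊) d
  have h3 := pow_le_geom_sum_mul (Nat.cast_nonneg ⌊C⌋₊) hk d
  have h4 : (I.revenue q G : ℝ) ≤ I.revenue q' G := NNReal.coe_le_coe.2 hle
  refine le_of_mul_le_mul_left ?_ h2
  have h5 : (0 : ℝ) ≤ I.val p := NNReal.coe_nonneg _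
  nlinarith [mul_le_mul_of_nonneg_right h3 h5, mul_le_mul_of_nonneg_left h4 h2.le]

end Instance

/-! ### Polynomial-time functions between encoded types -/

theorem Data.one_le_size (x : Data) : 1 ≤ x.size := by
  cases x <;> simp only [Data.size] <;> omega

/-- Since instructions are charged for argument and result, a time bound is also a bound on the
output size; this is what lets `PolyTime` functions compose. -/
theorem Prog.Runs.size_le {P : Prog} {x y : Data} {t : ℕ} (h : P.Runs x y t) :
    x.size ≤ t ∧ y.size ≤ t := by
  induction h with
  | op o x => omega
  | seq _ _ h1 h2 => omega
  | fork _ _ h1 h2 => simp only [Data.size]; omega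
  | cond_true _ _ _ h1 h2 => omega
  | cond_false _ _ h1 h2 => omega
  | loop_stop _ h1 => omega
  | loop_step _ _ _ _ h1 h2 h3 => omega

/-- Types whose elements are encoded as data. -/
class Enc (α : Type*) where
  enc : α → Data

open Enc

instance : Enc ℕ := ⟨.num⟩
instance : Enc Unit := ⟨fun _ => .num 0⟩
instance : Enc Bool := ⟨fun b => .num (if b then 1 else 0)⟩
instance : Enc ℚ≥0 := ⟨encodeRat⟩
instance {α β : Type*} [Enc α] [Enc β] : Enc (α × β) := ⟨fun x => .pair (enc x.1) (enc x.2)⟩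
instance {α : Type*} [Enc α] : Enc (List α) := ⟨fun l => .ofList (l.map enc)⟩

/-- The bit size of the encoding. -/
def esize {α : Type*} [Enc α] (a : α) : ℕ := (enc a).size

section

variable {α β γ δ σ : Type*} [Enc α] [Enc β] [Enc γ] [Enc δ] [Enc σ]

theorem esize_pair (a : α) (b : β) : esize (a, b) = 1 + esize a + esize b := rfl

theorem esize_nil : esize ([] : List α) = 1 := by
  simp [esize, enc, Data.ofList, Data.size]

theorem esize_cons (a : α) (l : List α) : esize (a :: l) = 1 + esize a + esize l := rfl

theorem esize_nat (n : ℕ) : esize n = 1 + Nat.size n := rfl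

theorem one_le_esize (a : α) : 1 ≤ esize a := Data.one_le_size _

theorem esize_bool_le (b : Bool) : esize b ≤ 2 := by
  cases b <;> simp [esize, enc, Data.size]

theorem esize_append (l l' : List α) : esize (l ++ l') + 1 = esize l + esize l' := by
  induction l with
  | nil => rw [List.nil_append, esize_nil]; omega
  | cons a l ih => rw [List.cons_append, esize_cons, esize_cons]; omega

theorem esize_reverse (l : List α) : esize l.reverse = esize l := by
  induction l with
  | nil => rfl
  | cons a l ih =>
    have := esize_append l.reverse [a]
    rw [List.reverse_cons, esize_cons]
    rw [esize_cons, esize_nil] at this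
    omega

theorem length_le_esize (l : List α) : l.length ≤ esize l := by
  induction l with
  | nil => simp
  | cons a l ih => rw [esize_cons, List.length_cons]; omega

theorem esize_le_of_mem {a : α} {l : List α} (h : a ∈ l) : esize a ≤ esize l := by
  induction l with
  | nil => simp at h
  | cons b l ih =>
    rw [esize_cons]
    rcases List.mem_cons.1 h with rfl | h
    · omega
    · have := ih h; omega

theorem esize_list_le {l : List α} {n : ℕ} (h : ∀ a ∈ l, esize a ≤ n) :
    esize l ≤ 1 + l.length * (n + 1) := by
  induction l with
  | nil => simp [esize_nil]
  | cons b l ih =>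
    have h1 := ih fun a ha => h a (List.mem_cons_of_mem _ ha)
    have h2 := h b List.mem_cons_self
    rw [esize_cons, List.length_cons, Nat.succ_mul]
    omega

theorem eval_mono (T : Polynomial ℕ) {a b : ℕ} (h : a ≤ b) : T.eval a ≤ T.eval b := by
  rw [Polynomial.eval_eq_sum, Polynomial.eval_eq_sum]
  exact Finset.sum_le_sum fun i _ => Nat.mul_le_mul_left _ (Nat.pow_le_pow_left h i)

/-- `b a` is bounded by a polynomial in the size of `a`. -/
def PolyBdd (b : α → ℕ) : Prop := ∃ T : Polynomial ℕ, ∀ a, b a ≤ T.eval (esize a)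

theorem PolyBdd.mono {b b' : α → ℕ} (h : PolyBdd b') (hb : ∀ a, b a ≤ b' a) : PolyBdd b := by
  obtain ⟨T, hT⟩ := h
  exact ⟨T, fun a => (hb a).trans (hT a)⟩

theorem PolyBdd.const (n : ℕ) : PolyBdd (fun _ : α => n) := ⟨Polynomial.C n, by simp⟩

theorem PolyBdd.size : PolyBdd (esize : α → ℕ) := ⟨Polynomial.X, by simp⟩

theorem PolyBdd.add {b b' : α → ℕ} (h : PolyBdd b) (h' : PolyBdd b') :
    PolyBdd fun a => b a + b' a := by
  obtain ⟨T, hT⟩ := h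
  obtain ⟨T', hT'⟩ := h'
  exact ⟨T + T', fun a => by rw [Polynomial.eval_add]; exact Nat.add_le_add (hT a) (hT' a)⟩

theorem PolyBdd.mul {b b' : α → ℕ} (h : PolyBdd b) (h' : PolyBdd b') :
    PolyBdd fun a => b a * b' a := by
  obtain ⟨T, hT⟩ := h
  obtain ⟨T', hT'⟩ := h'
  exact ⟨T * T', fun a => by rw [Polynomial.eval_mul]; exact Nat.mul_le_mul (hT a) (hT' a)⟩

theorem PolyBdd.eval {b : α → ℕ} (h : PolyBdd b) (T : Polynomial ℕ) :
    PolyBdd fun a => T.eval (b a) := by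
  obtain ⟨T', hT'⟩ := h
  exact ⟨T.comp T', fun a => by rw [Polynomial.eval_comp]; exact eval_mono T (hT' a)⟩

theorem PolyBdd.comp {b : β → ℕ} (h : PolyBdd b) {f : α → β}
    (hf : PolyBdd fun a => esize (f a)) : PolyBdd fun a => b (f a) := by
  obtain ⟨T, hT⟩ := h
  exact (hf.eval T).mono fun a => hT _

/-- `f` is computed by a program in polynomial time. -/
def PolyTime (f : α → β) : Prop :=
  ∃ P : Prog, ∃ t : α → ℕ, PolyBdd t ∧ ∀ a, ∃ s ≤ t a, P.Runs (enc a) (enc (f a)) s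

theorem PolyTime.bdd {f : α → β} (h : PolyTime f) : PolyBdd fun a => esize (f a) := by
  obtain ⟨P, t, ht, h⟩ := h
  refine ht.mono fun a => ?_
  obtain ⟨s, hs, hr⟩ := h a
  exact hr.size_le.2.trans hs

theorem PolyTime.congr {f g : α → β} (h : PolyTime f) (hg : ∀ a, g a = f a) : PolyTime g := by
  rwa [show g = f from funext hg]

theorem PolyTime.of_op {f : α → β} (o : Op) (h : ∀ a, o.apply (enc a) = enc (f a))
    (hf : PolyBdd fun a => esize (f a)) : PolyTime f := by
  refine ⟨.op o, _, ((PolyBdd.const 1).add PolyBdd.size).add hf, fun a => ⟨_, le_rfl, ?_⟩⟩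
  have := Prog.Runs.op o (enc a)
  rwa [h] at this

theorem PolyTime.id : PolyTime (fun a : α => a) := .of_op .id (fun _ => rfl) PolyBdd.size

theorem PolyTime.const (b : β) : PolyTime (fun _ : α => b) :=
  .of_op (.const (enc b)) (fun _ => rfl) (PolyBdd.const _)

theorem PolyTime.fst : PolyTime (fun x : α × β => x.1) :=
  .of_op .fst (fun _ => rfl) (PolyBdd.size.mono fun x => by
    rw [show esize x = _ from esize_pair x.1 x.2]; omega)

theorem PolyTime.snd : PolyTime (fun x : α × β => x.2) :=
  .of_op .snd (fun _ => rfl) (PolyBdd.size.mono fun x => by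
    rw [show esize x = _ from esize_pair x.1 x.2]; omega)

theorem PolyTime.comp {g : β → γ} {f : α → β} (hg : PolyTime g) (hf : PolyTime f) :
    PolyTime fun a => g (f a) := by
  have hs := hf.bdd
  obtain ⟨P, t, ht, h⟩ := hf
  obtain ⟨Q, t', ht', h'⟩ := hg
  refine ⟨.seq P Q, _, (ht.add (ht'.comp hs)).add (PolyBdd.const 1), fun a => ?_⟩
  obtain ⟨s, hs, hr⟩ := h a
  obtain ⟨s', hs', hr'⟩ := h' (f a)
  exact ⟨_, by omega, hr.seq hr'⟩

theorem PolyTime.pair {g : α → γ} {f : α → β} (hf : PolyTime f) (hg : PolyTime g) :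
    PolyTime fun a => (f a, g a) := by
  obtain ⟨P, t, ht, h⟩ := hf
  obtain ⟨Q, t', ht', h'⟩ := hg
  refine ⟨.fork P Q, _, (ht.add ht').add (PolyBdd.const 1), fun a => ?_⟩
  obtain ⟨s, hs, hr⟩ := h a
  obtain ⟨s', hs', hr'⟩ := h' a
  exact ⟨_, by omega, hr.fork hr'⟩

theorem PolyTime.ite {c : α → Bool} {f g : α → β} (hc : PolyTime c) (hf : PolyTime f)
    (hg : PolyTime g) : PolyTime fun a => if c a then f a else g a := by
  obtain ⟨P, t, ht, h⟩ := hc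
  obtain ⟨Q, t', ht', h'⟩ := hf
  obtain ⟨Q', t'', ht'', h''⟩ := hg
  refine ⟨.cond P Q Q', _, ((ht.add ht').add ht'').add (PolyBdd.const 1), fun a => ?_⟩
  obtain ⟨s, hs, hr⟩ := h a
  obtain ⟨s', hs', hr'⟩ := h' a
  obtain ⟨s'', hs'', hr''⟩ := h'' a
  dsimp only
  cases hca : c a
  · rw [hca] at hr
    exact ⟨s + s'' + 1, by omega, .cond_false hr hr''⟩
  · rw [hca] at hr
    exact ⟨s + s' + 1, by omega, .cond_true hr (by simp [enc]) hr'⟩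

theorem PolyTime.not {c : α → Bool} (h : PolyTime c) : PolyTime fun a => !c a :=
  (h.ite (.const false) (.const true)).congr fun a => by cases c a <;> rfl

theorem PolyTime.and {c c' : α → Bool} (h : PolyTime c) (h' : PolyTime c') :
    PolyTime fun a => c a && c' a :=
  (h.ite h' (.const false)).congr fun a => by cases c a <;> rfl

theorem PolyTime.or {c c' : α → Bool} (h : PolyTime c) (h' : PolyTime c') :
    PolyTime fun a => c a || c' a :=
  (h.ite (.const true) h').congr fun a => by cases c a <;> rfl

/-! #### Arithmetic -/

theorem esize_le_of_lt_two_pow {n k : ℕ} (h : n < 2 ^ k) : esize n ≤ k + 1 := by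
  rw [esize_nat]
  have := Nat.size_le.2 h
  omega

theorem lt_two_pow_esize (n : ℕ) : n < 2 ^ esize n :=
  (Nat.lt_size_self n).trans_le (Nat.pow_le_pow_right two_pos (by rw [esize_nat]; omega))

theorem PolyTime.add {f g : α → ℕ} (hf : PolyTime f) (hg : PolyTime g) :
    PolyTime fun a => f a + g a := by
  refine PolyTime.comp (g := fun x : ℕ × ℕ => x.1 + x.2) (.of_op .add (fun _ => rfl) ?_)
    (hf.pair hg)
  refine (PolyBdd.size.add (PolyBdd.const 1)).mono fun x => esize_le_of_lt_two_pow ?_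
  have h1 := lt_two_pow_esize x.1
  have h2 := lt_two_pow_esize x.2
  have h3 : 2 ^ esize x.1 ≤ 2 ^ (esize x.1 + esize x.2) :=
    Nat.pow_le_pow_right two_pos (by omega)
  have h4 : 2 ^ esize x.2 ≤ 2 ^ (esize x.1 + esize x.2) :=
    Nat.pow_le_pow_right two_pos (by omega)
  rw [show esize x = _ from esize_pair x.1 x.2, add_assoc, pow_add]
  omega

theorem PolyTime.mul {f g : α → ℕ} (hf : PolyTime f) (hg : PolyTime g) :
    PolyTime fun a => f a * g a := by
  refine PolyTime.comp (g := fun x : ℕ × ℕ => x.1 * x.2) (.of_op .mul (fun _ => rfl) ?_)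
    (hf.pair hg)
  refine (PolyBdd.size.add (PolyBdd.const 1)).mono fun x => esize_le_of_lt_two_pow ?_
  have h1 := lt_two_pow_esize x.1
  have h2 := lt_two_pow_esize x.2
  calc x.1 * x.2 < 2 ^ esize x.1 * 2 ^ esize x.2 :=
        Nat.mul_lt_mul_of_lt_of_lt h1 h2
    _ ≤ _ := by
      rw [← pow_add]
      refine Nat.pow_le_pow_right two_pos ?_
      rw [show esize x = _ from esize_pair x.1 x.2]; omega

theorem PolyTime.le {f g : α → ℕ} (hf : PolyTime f) (hg : PolyTime g) :
    PolyTime fun a => decide (f a ≤ g a) := by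
  refine PolyTime.comp (g := fun x : ℕ × ℕ => decide (x.1 ≤ x.2)) (.of_op .le (fun x => ?_) ?_)
    (hf.pair hg)
  · show Data.num _ = Data.num _
    simp
  · exact (PolyBdd.const 2).mono fun x => esize_bool_le _

theorem PolyTime.eq {f g : α → ℕ} (hf : PolyTime f) (hg : PolyTime g) :
    PolyTime fun a => decide (f a = g a) :=
  ((hf.le hg).and (hg.le hf)).congr fun a => by
    rw [← Bool.decide_and, decide_eq_decide]; omega

theorem PolyTime.num {f : α → ℚ≥0} (hf : PolyTime f) : PolyTime fun a => (f a).num := by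
  refine PolyTime.comp (g := fun x : ℚ≥0 => x.num) (.of_op .fst (fun _ => rfl) ?_) hf
  exact PolyBdd.size.mono fun x => by
    simp only [esize, enc, encodeRat, Data.size]; omega

theorem PolyTime.den {f : α → ℚ≥0} (hf : PolyTime f) : PolyTime fun a => (f a).den := by
  refine PolyTime.comp (g := fun x : ℚ≥0 => x.den) (.of_op .snd (fun _ => rfl) ?_) hf
  exact PolyBdd.size.mono fun x => by
    simp only [esize, enc, encodeRat, Data.size]; omega

/-! #### Loops and lists -/

theorem runs_loop {c : σ → Bool} {g : σ → σ} {P Q : Prog} {tc tg : ℕ} (n : ℕ) (s : σ)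
    (hP : ∀ i ≤ n, ∃ t ≤ tc, P.Runs (enc (g^[i] s)) (enc (c (g^[i] s))) t)
    (hQ : ∀ i < n, ∃ t ≤ tg, Q.Runs (enc (g^[i] s)) (enc (g^[i + 1] s)) t)
    (h1 : ∀ i < n, c (g^[i] s) = true) (h2 : c (g^[n] s) = false) :
    ∃ t ≤ (n + 1) * (tc + tg + 1), (Prog.loop P Q).Runs (enc s) (enc (g^[n] s)) t := by
  induction n generalizing s with
  | zero =>
    obtain ⟨t, ht, hr⟩ := hP 0 le_rfl
    rw [h2] at hr
    refine ⟨t + 1, ?_, Prog.Runs.loop_stop hr⟩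
    omega
  | succ n ih =>
    obtain ⟨t, ht, hr⟩ := hP 0 (by omega)
    obtain ⟨t', ht', hr'⟩ := hQ 0 (by omega)
    obtain ⟨t'', ht'', hr''⟩ := ih (g s)
      (fun i hi => by simpa only [← Function.iterate_succ_apply] using hP (i + 1) (by omega))
      (fun i hi => by simpa only [← Function.iterate_succ_apply] using hQ (i + 1) (by omega))
      (fun i hi => by simpa only [← Function.iterate_succ_apply] using h1 (i + 1) (by omega))
      (by simpa only [← Function.iterate_succ_apply] using h2)
    rw [h1 0 (by omega)] at hr
    refine ⟨t + t' + t'' + 1, ?_, .loop_step hr (by simp [enc]) hr' hr''⟩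
    rw [Nat.succ_mul (n + 1)]
    omega

/-- Polynomially many polynomial-time steps can still blow up the data, so a size bound `S` for all
intermediate states is required separately. -/
theorem PolyTime.loop {c : σ → Bool} {g : σ → σ} (hc : PolyTime c) (hg : PolyTime g) {n S : σ → ℕ}
    (hn : PolyBdd n) (hS : PolyBdd S) (hsize : ∀ s, ∀ i ≤ n s, esize (g^[i] s) ≤ S s)
    (h1 : ∀ s, ∀ i < n s, c (g^[i] s) = true) (h2 : ∀ s, c (g^[n s] s) = false) :
    PolyTime fun s => g^[n s] s := by
  obtain ⟨P, t, ⟨T, hT⟩, h⟩ := hc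
  obtain ⟨Q, t', ⟨T', hT'⟩, h'⟩ := hg
  refine ⟨.loop P Q, _, (hn.add (.const 1)).mul (((hS.eval T).add (hS.eval T')).add (.const 1)),
    fun s => runs_loop (n s) s (fun i hi => ?_) (fun i hi => ?_) (h1 s) (h2 s)⟩
  · obtain ⟨u, hu, hr⟩ := h (g^[i] s)
    exact ⟨u, hu.trans ((hT _).trans (eval_mono T (hsize s i hi))), hr⟩
  · obtain ⟨u, hu, hr⟩ := h' (g^[i] s)
    rw [Function.iterate_succ_apply']
    exact ⟨u, hu.trans ((hT' _).trans (eval_mono T' (hsize s i hi.le))), hr⟩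

theorem PolyTime.cons {f : α → β} {g : α → List β} (hf : PolyTime f) (hg : PolyTime g) :
    PolyTime fun a => f a :: g a := by
  -- A list cell is encoded as the pair of its head and tail, so nothing has to be computed.
  refine PolyTime.comp (g := fun x : β × List β => x.1 :: x.2) (.of_op .id (fun _ => rfl) ?_)
    (hf.pair hg)
  exact PolyBdd.size

theorem PolyTime.isCons {f : α → List β} (hf : PolyTime f) :
    PolyTime fun a => !(f a).isEmpty := by
  refine PolyTime.comp (g := fun x : List β => !x.isEmpty) (.of_op .isPair (fun x => ?_) ?_) hf
  · cases x <;> rfl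
  · exact (PolyBdd.const 2).mono fun x => esize_bool_le _

/-- Case distinction on a list. -/
def listCases {α β γ : Type*} (f : γ → β) (g : γ × α × List α → β) : γ × List α → β
  | (c, []) => f c
  | (c, a :: l) => g (c, a, l)

theorem PolyTime.listCases {f : γ → β} {g : γ × α × List α → β} (hf : PolyTime f)
    (hg : PolyTime g) : PolyTime (listCases f g) := by
  obtain ⟨P, t, ht, h⟩ := PolyTime.isCons (PolyTime.snd (α := γ) (β := List α))
  obtain ⟨Q, t', ht', h'⟩ := hg
  obtain ⟨Q', t'', ht'', h''⟩ := hf.comp (PolyTime.fst (α := γ) (β := List α))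
  obtain ⟨T', hT'⟩ := ht'
  refine ⟨.cond P Q Q', _, ((ht.add (PolyBdd.size.eval T')).add ht'').add (PolyBdd.const 1), ?_⟩
  rintro ⟨c, _ | ⟨a, l⟩⟩
  · obtain ⟨s, hs, hr⟩ := h (c, [])
    obtain ⟨s'', hs'', hr''⟩ := h'' (c, [])
    exact ⟨_, by omega, .cond_false hr hr''⟩
  · obtain ⟨s, hs, hr⟩ := h (c, a :: l)
    obtain ⟨s', hs', hr'⟩ := h' (c, a, l)
    -- `(c, a, l)` and `(c, a :: l)` have the same encoding.
    have h3 : t' (c, a, l) ≤ T'.eval (esize (c, a :: l)) := hT' (c, a, l)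
    refine ⟨s + s' + 1, by omega, .cond_true hr ?_ hr'⟩
    simp [enc]

theorem foldl_iterate {α γ σ : Type*} (g : γ × σ × α → σ) (c : γ) (s : σ) (l : List α) (i : ℕ) (hi : i ≤ l.length) :
    (Pricing.listCases (fun x : γ × σ => (x, ([] : List α)))
      (fun x => ((x.1.1, g (x.1.1, x.1.2, x.2.1)), x.2.2)))^[i] ((c, s), l) =
      ((c, (l.take i).foldl (fun s a => g (c, s, a)) s), l.drop i) := by
  induction i generalizing s l with
  | zero => simp
  | succ i ih =>
    cases l with
    | nil => simp at hi
    | cons a l =>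
      rw [Function.iterate_succ_apply, List.take_succ_cons, List.drop_succ_cons, List.foldl_cons,
        ← ih _ _ (by simpa using hi)]
      rfl

/-- In `hsize`, `l` is the prefix processed so far and `l'` the rest: each intermediate state has to
be bounded in terms of the whole input. -/
theorem PolyTime.foldl {g : γ × σ × α → σ} (hg : PolyTime g) {S : (γ × σ) × List α → ℕ}
    (hS : PolyBdd S)
    (hsize : ∀ c s l l', esize (l.foldl (fun s a => g (c, s, a)) s) ≤ S ((c, s), l ++ l')) :
    PolyTime fun x : (γ × σ) × List α => x.2.foldl (fun s a => g (x.1.1, s, a)) x.1.2 := by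
  have hstep : PolyTime (Pricing.listCases (fun x : γ × σ => (x, ([] : List α)))
      (fun x => ((x.1.1, g (x.1.1, x.1.2, x.2.1)), x.2.2))) := by
    refine PolyTime.listCases (PolyTime.id.pair (.const _)) ?_
    have h1 : PolyTime fun x : (γ × σ) × α × List α => x.1.1 := PolyTime.fst.comp PolyTime.fst
    have h2 : PolyTime fun x : (γ × σ) × α × List α => x.1.2 := PolyTime.snd.comp PolyTime.fst
    have h3 : PolyTime fun x : (γ × σ) × α × List α => x.2.1 := PolyTime.fst.comp PolyTime.snd
    exact (h1.pair (hg.comp (h1.pair (h2.pair h3)))).pair (PolyTime.snd.comp PolyTime.snd)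
  have hloop := PolyTime.loop (PolyTime.isCons (PolyTime.snd (α := γ × σ) (β := List α))) hstep
    (n := fun x => x.2.length) (S := fun x => esize x + S x + 2)
    (PolyBdd.size.mono fun x => by
      have := length_le_esize x.2
      rw [show esize x = _ from esize_pair x.1 x.2]; omega)
    ((PolyBdd.size.add hS).add (.const 2))
    (fun ⟨⟨c, s⟩, l⟩ i hi => by
      rw [foldl_iterate g c s l i hi]
      have h1 := hsize c s (l.take i) (l.drop i)
      rw [List.take_append_drop] at h1
      have h2 := esize_append (l.take i) (l.drop i)
      rw [List.take_append_drop] at h2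
      have h3 := one_le_esize (l.take i)
      simp only [esize_pair]
      omega)
    (fun ⟨⟨c, s⟩, l⟩ i hi => by
      rw [foldl_iterate g c s l i (le_of_lt hi)]
      simpa using hi)
    (fun ⟨⟨c, s⟩, l⟩ => by
      rw [foldl_iterate g c s l _ le_rfl]
      simp)
  refine ((PolyTime.snd.comp PolyTime.fst).comp hloop).congr ?_
  rintro ⟨⟨c, s⟩, l⟩
  rw [foldl_iterate g c s l _ le_rfl]
  simp

theorem PolyTime.reverseAppend {f g : α → List β} (hf : PolyTime f) (hg : PolyTime g) :
    PolyTime fun a => (f a).reverse ++ g a := by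
  have h := PolyTime.foldl (γ := Unit) (g := fun x : Unit × List β × β => x.2.2 :: x.2.1)
    (S := esize)
    ((PolyTime.snd.comp PolyTime.snd).cons (PolyTime.fst.comp PolyTime.snd)) PolyBdd.size
    (fun c s l l' => by
      have h1 := esize_append l.reverse s
      have h2 := esize_append l l'
      have h3 := one_le_esize l'
      rw [esize_reverse] at h1
      simp only [List.foldl_flip_cons_eq_append', esize_pair]
      omega)
  refine (h.comp (((PolyTime.const ()).pair hg).pair hf)).congr fun a => ?_
  simp

theorem PolyTime.reverse {f : α → List β} (hf : PolyTime f) : PolyTime fun a => (f a).reverse :=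
  (hf.reverseAppend (.const [])).congr fun a => by simp

theorem foldl_reverse_append {α β : Type*} (f : α → List β) (l : List α) (s : List β) :
    l.foldl (fun s a => (f a).reverse ++ s) s = (l.flatMap f).reverse ++ s := by
  induction l generalizing s with
  | nil => simp
  | cons a l ih => simp [ih]

theorem esize_flatMap_le {α : Type*} (f : α → List β) (l : List α) {n : ℕ}
    (h : ∀ a ∈ l, esize (f a) ≤ n) : esize (l.flatMap f) ≤ 1 + l.length * n := by
  induction l with
  | nil => simp [esize_nil]
  | cons a l ih =>
    have h1 := ih fun a ha => h a (List.mem_cons_of_mem _ ha)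
    have h2 := h a List.mem_cons_self
    have h3 := esize_append (f a) (l.flatMap f)
    rw [List.flatMap_cons, List.length_cons, Nat.succ_mul]
    omega

/-- The fold prepends reversed blocks to an accumulator; one reversal at the end restores the order.
-/
theorem PolyTime.flatMap {f : γ × α → List β} (hf : PolyTime f) {c : δ → γ} {l : δ → List α}
    (hc : PolyTime c) (hl : PolyTime l) :
    PolyTime fun x => (l x).flatMap fun a => f (c x, a) := by
  obtain ⟨T, hT⟩ := hf.bdd
  have hg : PolyTime fun x : γ × List β × α => (f (x.1, x.2.2)).reverse ++ x.2.1 :=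
    (hf.comp (PolyTime.fst.pair (PolyTime.snd.comp PolyTime.snd))).reverseAppend
      (PolyTime.fst.comp PolyTime.snd)
  have h := PolyTime.foldl hg
    (S := fun x => esize x + (1 + esize x * T.eval (esize x)))
    (PolyBdd.size.add ((PolyBdd.const 1).add (PolyBdd.size.mul (PolyBdd.size.eval T))))
    (fun c s l l' => by
      dsimp only
      rw [foldl_reverse_append]
      have h1 := esize_append (l.flatMap fun a => f (c, a)).reverse s
      rw [esize_reverse] at h1
      have h2 := esize_append l l'
      have h3 := one_le_esize l'
      have h4 := length_le_esize l
      have h5 := esize_flatMap_le (fun a => f (c, a)) l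
        (n := T.eval (esize ((c, s), l ++ l'))) (fun a ha => (hT _).trans (eval_mono T (by
          have := esize_le_of_mem ha
          simp only [esize_pair]
          omega)))
      have h6 : l.length * T.eval (esize ((c, s), l ++ l')) ≤
          esize ((c, s), l ++ l') * T.eval (esize ((c, s), l ++ l')) :=
        Nat.mul_le_mul_right _ (by simp only [esize_pair]; omega)
      have h7 : esize s ≤ esize ((c, s), l ++ l') := by
        simp only [esize_pair]; omega
      omega)
  refine (PolyTime.reverse (h.comp ((hc.pair (.const [])).pair hl))).congr fun x => ?_
  dsimp only
  rw [foldl_reverse_append, List.append_nil, List.reverse_reverse]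

theorem PolyTime.map {f : γ × α → β} (hf : PolyTime f) {c : δ → γ} {l : δ → List α}
    (hc : PolyTime c) (hl : PolyTime l) : PolyTime fun x => (l x).map fun a => f (c x, a) :=
  ((hf.cons (.const [])).flatMap hc hl).congr fun x => by
    rw [List.map_eq_flatMap]

theorem PolyTime.filter {f : γ × α → Bool} (hf : PolyTime f) {c : δ → γ} {l : δ → List α}
    (hc : PolyTime c) (hl : PolyTime l) : PolyTime fun x => (l x).filter fun a => f (c x, a) :=
  ((hf.ite (PolyTime.snd.cons (.const [])) (.const [])).flatMap hc hl).congr fun x => by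
    dsimp only
    induction l x with
    | nil => rfl
    | cons a l ih =>
      rw [List.filter_cons, List.flatMap_cons, ih]
      split_ifs <;> rfl

theorem PolyTime.length {l : δ → List α} (hl : PolyTime l) : PolyTime fun x => (l x).length := by
  have h0 : ∀ (l : List α) (s : ℕ), l.foldl (fun s _ => s + 1) s = s + l.length := fun l => by
    induction l with
    | nil => simp
    | cons a l ih => intro s; rw [List.foldl_cons, ih, List.length_cons]; omega
  have h := PolyTime.foldl (γ := Unit) (α := α) (g := fun x => x.2.1 + 1)
    (S := fun x => esize x + 1)
    ((PolyTime.fst.comp PolyTime.snd).add (.const 1))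
    (PolyBdd.size.add (.const 1)) (fun c s l l' => by
      rw [h0]
      refine esize_le_of_lt_two_pow ?_
      have h1 := esize_append l l'
      have h2 := one_le_esize l'
      have h3 := length_le_esize l
      have h4 : s + l.length < 2 ^ (esize s + esize l) := by
        rw [pow_add]
        have h5 := lt_two_pow_esize s
        have h6 : esize l < 2 ^ esize l := Nat.lt_two_pow_self
        nlinarith
      refine h4.trans_le (Nat.pow_le_pow_right two_pos ?_)
      simp only [esize_pair]
      omega)
  refine (h.comp (((PolyTime.const ()).pair (.const 0)).pair hl)).congr fun x => ?_
  dsimp only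
  rw [h0, zero_add]

theorem foldl_zipIdx {α : Type*} (l : List α) (n : ℕ) (s : List (α × ℕ)) :
    l.foldl (fun s a => (s.1 + 1, (a, s.1) :: s.2)) (n, s) =
      (n + l.length, (l.zipIdx n).reverse ++ s) := by
  induction l generalizing n s with
  | nil => simp
  | cons a l ih => simp [ih, List.zipIdx_cons]; omega

theorem PolyTime.zipIdx {l : δ → List α} (hl : PolyTime l) : PolyTime fun x => (l x).zipIdx := by
  have h1 : PolyTime fun x : Unit × (ℕ × List (α × ℕ)) × α => x.2.1.1 :=
    PolyTime.fst.comp (PolyTime.fst.comp PolyTime.snd)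
  have h := PolyTime.foldl (γ := Unit) (α := α) (σ := ℕ × List (α × ℕ))
    (g := fun x => (x.2.1.1 + 1, (x.2.2, x.2.1.1) :: x.2.1.2))
    (S := fun x => esize x + 10 + (esize x) * (2 * esize x + 10))
    ((h1.add (.const 1)).pair (((PolyTime.snd.comp PolyTime.snd).pair h1).cons
      (PolyTime.snd.comp (PolyTime.fst.comp PolyTime.snd))))
    ((PolyBdd.size.add (.const 10)).add
      (PolyBdd.size.mul (((PolyBdd.const 2).mul PolyBdd.size).add (.const 10))))
    (fun c s l l' => by
      obtain ⟨n, s⟩ := s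
      dsimp only
      rw [foldl_zipIdx, esize_pair]
      have h1 := esize_append (l.zipIdx n).reverse s
      rw [esize_reverse] at h1
      have h2 := esize_append l l'
      have h3 := one_le_esize l'
      have h4 := length_le_esize l
      have h5 : n + l.length < 2 ^ (esize n + esize l) := by
        rw [pow_add]
        have h5 := lt_two_pow_esize n
        have h6 : esize l < 2 ^ esize l := Nat.lt_two_pow_self
        nlinarith
      set X := esize ((c, (n, s)), l ++ l') with hX
      simp only [esize_pair] at hX
      have h6 : esize (l.zipIdx n) ≤ 1 + (l.zipIdx n).length * ((2 * X + 2) + 1) := by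
        refine esize_list_le fun y hy => ?_
        obtain ⟨a, i⟩ := y
        have h7 := esize_le_of_mem (List.fst_mem_of_mem_zipIdx hy)
        have h8 : i < n + l.length := List.snd_lt_add_of_mem_zipIdx hy
        have h9 := esize_le_of_lt_two_pow (h8.trans h5)
        rw [esize_pair]
        dsimp only at h7
        omega
      have h7 := esize_le_of_lt_two_pow h5
      rw [List.length_zipIdx] at h6
      have h8 : l.length * ((2 * X + 2) + 1) ≤ X * (2 * X + 10) :=
        Nat.mul_le_mul (by omega) (by omega)
      omega)
  refine (PolyTime.reverse (PolyTime.snd.comp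
    (h.comp (((PolyTime.const ()).pair (.const (0, []))).pair hl)))).congr fun x => ?_
  dsimp only
  rw [foldl_zipIdx]
  simp

/-! #### Fractions -/

theorem PolyTime.minRat {f g : α → ℚ≥0} (hf : PolyTime f) (hg : PolyTime g) :
    PolyTime fun a => min (f a) (g a) :=
  (((hf.num.mul hg.den).le (hg.num.mul hf.den)).ite hf hg).congr fun a => by
    simp only [min_def, decide_eq_true_eq, NNRat.le_def]

theorem foldl_min_mem (l : List ℚ≥0) (b : ℚ≥0) : l.foldl min b ∈ b :: l := by
  induction l generalizing b with
  | nil => simp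
  | cons a l ih =>
    rw [List.foldl_cons]
    rcases List.mem_cons.1 (ih (min b a)) with h | h
    · rw [h]
      rcases min_choice b a with h' | h' <;> simp [h']
    · simp [h]

/-- The smallest member of a list, `0` for the empty list. -/
def listMin : List ℚ≥0 → ℚ≥0
  | [] => 0
  | b :: l => l.foldl min b

theorem PolyTime.listMin {l : δ → List ℚ≥0} (hl : PolyTime l) :
    PolyTime fun x => listMin (l x) := by
  have h := PolyTime.foldl (γ := Unit) (α := ℚ≥0) (σ := ℚ≥0) (g := fun x => min x.2.1 x.2.2)
    (S := esize)
    ((PolyTime.fst.comp PolyTime.snd).minRat (PolyTime.snd.comp PolyTime.snd)) PolyBdd.size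
    (fun c s l l' => by
      have h1 := esize_le_of_mem (foldl_min_mem l s)
      have h2 := esize_append l l'
      have h3 := one_le_esize l'
      rw [esize_cons] at h1
      simp only [esize_pair]
      refine h1.trans ?_
      omega)
  have h' := PolyTime.listCases (α := ℚ≥0) (γ := Unit) (f := fun _ => (0 : ℚ≥0))
    (g := fun x => x.2.2.foldl min x.2.1) (.const 0)
    (h.comp (((PolyTime.const ()).pair (PolyTime.fst.comp PolyTime.snd)).pair
      (PolyTime.snd.comp PolyTime.snd)))
  refine (h'.comp ((PolyTime.const ()).pair hl)).congr fun x => ?_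
  cases l x <;> rfl

/-- The sum of a list of fractions, not in lowest terms. -/
def fracSum (l : List ℚ≥0) : ℕ × ℕ :=
  l.foldl (fun s q => (s.1 * q.den + q.num * s.2, s.2 * q.den)) (0, 1)

/-- Numerator plus denominator grows at most by the factor `q.num + q.den` in each step, so bit
sizes add up. Polynomial size thus needs no reduction to lowest terms. -/
theorem foldl_frac_lt (l : List ℚ≥0) (s : ℕ × ℕ) (k : ℕ) (h : s.1 + s.2 < 2 ^ k) :
    (l.foldl (fun s q => (s.1 * q.den + q.num * s.2, s.2 * q.den)) s).1 +
      (l.foldl (fun s q => (s.1 * q.den + q.num * s.2, s.2 * q.den)) s).2 <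
        2 ^ (k + esize l) := by
  induction l generalizing s k with
  | nil => exact h.trans_le (Nat.pow_le_pow_right two_pos (by omega))
  | cons q l ih =>
    rw [List.foldl_cons, esize_cons]
    have h1 : q.num + q.den < 2 ^ esize q := by
      have h1 := lt_two_pow_esize q.num
      have h2 := lt_two_pow_esize q.den
      have h3 : esize q = 1 + esize q.num + esize q.den := rfl
      have h4 : 2 ^ esize q.num ≤ 2 ^ (esize q.num + esize q.den) :=
        Nat.pow_le_pow_right two_pos (by omega)
      have h5 : 2 ^ esize q.den ≤ 2 ^ (esize q.num + esize q.den) :=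
        Nat.pow_le_pow_right two_pos (by omega)
      rw [h3, add_assoc, pow_add]
      omega
    refine (ih _ (k + esize q) ?_).trans_le (Nat.pow_le_pow_right two_pos (by omega))
    rw [pow_add]
    have h2 := Nat.mul_lt_mul_of_lt_of_lt h h1
    dsimp only
    nlinarith

theorem PolyTime.fracSum {l : δ → List ℚ≥0} (hl : PolyTime l) :
    PolyTime fun x => fracSum (l x) := by
  have h1 : PolyTime fun x : Unit × (ℕ × ℕ) × ℚ≥0 => x.2.1.1 :=
    PolyTime.fst.comp (PolyTime.fst.comp PolyTime.snd)
  have h2 : PolyTime fun x : Unit × (ℕ × ℕ) × ℚ≥0 => x.2.1.2 :=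
    PolyTime.snd.comp (PolyTime.fst.comp PolyTime.snd)
  have h3 : PolyTime fun x : Unit × (ℕ × ℕ) × ℚ≥0 => x.2.2 := PolyTime.snd.comp PolyTime.snd
  have h := PolyTime.foldl (γ := Unit) (α := ℚ≥0) (σ := ℕ × ℕ)
    (g := fun x => (x.2.1.1 * x.2.2.den + x.2.2.num * x.2.1.2, x.2.1.2 * x.2.2.den))
    (S := fun x => 2 * esize x + 10)
    (((h1.mul h3.den).add (h3.num.mul h2)).pair (h2.mul h3.den))
    (((PolyBdd.const 2).mul PolyBdd.size).add (.const 10)) (fun c s l l' => by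
      have h1 : s.1 + s.2 < 2 ^ esize s := by
        have h1 := lt_two_pow_esize s.1
        have h2 := lt_two_pow_esize s.2
        have h3 : esize s = 1 + esize s.1 + esize s.2 := rfl
        have h4 : 2 ^ esize s.1 ≤ 2 ^ (esize s.1 + esize s.2) :=
          Nat.pow_le_pow_right two_pos (by omega)
        have h5 : 2 ^ esize s.2 ≤ 2 ^ (esize s.1 + esize s.2) :=
          Nat.pow_le_pow_right two_pos (by omega)
        rw [h3, add_assoc, pow_add]
        omega
      have h2 := foldl_frac_lt l s _ h1
      dsimp only
      set r := l.foldl (fun s q => (s.1 * q.den + q.num * s.2, s.2 * q.den)) s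
      have h3 : esize r.1 ≤ _ := esize_le_of_lt_two_pow ((Nat.le_add_right _ _).trans_lt h2)
      have h4 : esize r.2 ≤ _ := esize_le_of_lt_two_pow ((Nat.le_add_left _ _).trans_lt h2)
      have h5 : esize r = 1 + esize r.1 + esize r.2 := rfl
      have h6 := esize_append l l'
      have h7 := one_le_esize l'
      simp only [esize_pair]
      omega)
  exact h.comp (((PolyTime.const ()).pair (.const (0, 1))).pair hl)

theorem foldl_frac (l : List ℚ≥0) (s : ℕ × ℕ) (hs : s.2 ≠ 0) :
    (l.foldl (fun s q => (s.1 * q.den + q.num * s.2, s.2 * q.den)) s).2 ≠ 0 ∧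
      (((l.foldl (fun s q => (s.1 * q.den + q.num * s.2, s.2 * q.den)) s).1 : ℚ≥0) /
      ((l.foldl (fun s q => (s.1 * q.den + q.num * s.2, s.2 * q.den)) s).2 : ℚ≥0)) =
        s.1 / s.2 + l.sum := by
  induction l generalizing s with
  | nil => simpa using hs
  | cons q l ih =>
    rw [List.foldl_cons]
    have hq := q.den_ne_zero
    obtain ⟨h1, h2⟩ := ih (s.1 * q.den + q.num * s.2, s.2 * q.den) (mul_ne_zero hs hq)
    refine ⟨h1, h2.trans ?_⟩
    rw [List.sum_cons, ← add_assoc]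
    congr 1
    have h3 : (s.2 : ℚ≥0) ≠ 0 := Nat.cast_ne_zero.2 hs
    have h4 : (q.den : ℚ≥0) ≠ 0 := Nat.cast_ne_zero.2 hq
    have h5 : q = q.num / q.den := (NNRat.num_div_den q).symm
    conv_rhs => rw [h5]
    push_cast
    field_simp

theorem fracSum_spec (l : List ℚ≥0) :
    (fracSum l).2 ≠ 0 ∧ ((fracSum l).1 : ℚ≥0) / (fracSum l).2 = l.sum := by
  simpa [fracSum] using foldl_frac l (0, 1) one_ne_zero

end

/-! ### The local search algorithm -/

/-- A customer in the list that the algorithm works on: whether it is served, its number, its two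
items, and its budget. -/
abbrev Customer := Bool × ℕ × (ℕ × ℕ) × ℚ≥0

namespace Customer

/-- The item of `L` that the customer wants. -/
def left (r : Customer) : ℕ := r.2.2.1.1

/-- The item of `R` that the customer wants. -/
def right (r : Customer) : ℕ := r.2.2.1.2

theorem polyTime_left : PolyTime left :=
  PolyTime.fst.comp (PolyTime.fst.comp (PolyTime.snd.comp PolyTime.snd))

theorem polyTime_right : PolyTime right :=
  PolyTime.snd.comp (PolyTime.fst.comp (PolyTime.snd.comp PolyTime.snd))

end Customer

/-- The customers in `X` that are served and want the item `u`. -/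
def served (side : Customer → ℕ) (X : List Customer) (u : ℕ) : List Customer :=
  X.filter fun r => r.1 && decide (side r = u)

/-- Are the capacities, given by their codes, respected on one side? -/
def capsOk (side : Customer → ℕ) (cs : List (ℕ × ℕ)) (X : List Customer) : Bool :=
  (cs.filter fun c =>
    !(decide (c.1 = 0) || decide ((served side X c.2).length + 1 ≤ c.1))).isEmpty

/-- The best price for the item `u`. -/
def itemPrice (X : List Customer) (u : ℕ) : ℚ≥0 :=
  listMin ((served Customer.left X u).map fun r => r.2.2.2)

/-- The revenue, as a fraction. -/
def listRevenue (X : List Customer) : ℕ × ℕ :=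
  fracSum ((X.filter fun r => r.1).map fun r => itemPrice X r.left)

/-- Is the revenue of `Y` more than `1 + 1 / M` times that of `X`? -/
def better (M : ℕ) (X Y : List Customer) : Bool :=
  !decide (M * ((listRevenue Y).1 * (listRevenue X).2) ≤
    (M + 1) * ((listRevenue X).1 * (listRevenue Y).2))

/-- `X`, and all the results of changing the status of one customer in `X`. -/
def flips (X : List Customer) : List (List Customer) :=
  X :: X.map fun y => X.map fun z =>
    (if decide (z.2.1 = y.2.1) then !z.1 else z.1, z.2)

/-- The results of changing the status of at most `n` customers. -/
def neighbours : ℕ → List Customer → List (List Customer)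
  | 0, X => [X]
  | n + 1, X => (neighbours n X).flatMap flips

/-- The capacities on both sides, each with the number of its item. -/
abbrev Caps := List (ℕ × ℕ) × List (ℕ × ℕ)

/-- The number that determines the improvement that a step has to achieve. -/
def stepParam (c : ℕ) (cs : Caps) : ℕ := c * cs.1.length + 1

/-- The neighbours that the local search may proceed to. -/
def candidates (n c : ℕ) (cs : Caps) (X : List Customer) : List (List Customer) :=
  (neighbours n X).filter fun Y => (capsOk Customer.left cs.1 Y && capsOk Customer.right cs.2 Y) &&
    better (stepParam c cs) X Y

/-- The state: is the search still going on, the capacities, and the current solution. -/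
abbrev State := Bool × Caps × List Customer

/-- One step of the local search. -/
def step (n c : ℕ) (s : State) : State :=
  listCases (fun s : State => (false, s.2)) (fun x : State × List Customer × List (List Customer) =>
    (true, x.1.2.1, x.2.1)) (s, candidates n c s.2.1 s.2.2)

section

variable {δ : Type*} [Enc δ]

theorem PolyTime.served {side : Customer → ℕ} (hside : PolyTime side) {X : δ → List Customer}
    {u : δ → ℕ} (hX : PolyTime X) (hu : PolyTime u) :
    PolyTime fun x => served side (X x) (u x) :=
  PolyTime.filter (γ := ℕ) (f := fun y : ℕ × Customer => y.2.1 && decide (side y.2 = y.1))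
    ((PolyTime.fst.comp PolyTime.snd).and ((hside.comp PolyTime.snd).eq PolyTime.fst)) hu hX

theorem PolyTime.capsOk {side : Customer → ℕ} (hside : PolyTime side)
    {cs : δ → List (ℕ × ℕ)} {X : δ → List Customer} (hcs : PolyTime cs) (hX : PolyTime X) :
    PolyTime fun x => capsOk side (cs x) (X x) := by
  have h1 : PolyTime fun y : List Customer × ℕ × ℕ => y.2.1 := PolyTime.fst.comp PolyTime.snd
  have h2 := (PolyTime.filter (γ := List Customer) (f := fun y : List Customer × ℕ × ℕ =>
    !(decide (y.2.1 = 0) || decide ((Pricing.served side y.1 y.2.2).length + 1 ≤ y.2.1)))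
    (((h1.eq (.const 0)).or
      (((PolyTime.served hside PolyTime.fst (PolyTime.snd.comp PolyTime.snd)).length.add
        (.const 1)).le h1)).not) hX hcs).isCons.not
  exact h2.congr fun x => by simp [Pricing.capsOk]

theorem PolyTime.itemPrice {X : δ → List Customer} {u : δ → ℕ} (hX : PolyTime X)
    (hu : PolyTime u) : PolyTime fun x => itemPrice (X x) (u x) :=
  (PolyTime.map (γ := Unit) (f := fun y : Unit × Customer => y.2.2.2.2)
    (PolyTime.snd.comp (PolyTime.snd.comp (PolyTime.snd.comp PolyTime.snd))) (.const ())
    (PolyTime.served Customer.polyTime_left hX hu)).listMin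

theorem PolyTime.listRevenue {X : δ → List Customer} (hX : PolyTime X) :
    PolyTime fun x => listRevenue (X x) :=
  (PolyTime.map (γ := List Customer)
    (f := fun y : List Customer × Customer => Pricing.itemPrice y.1 y.2.left)
    (PolyTime.fst.itemPrice (Customer.polyTime_left.comp PolyTime.snd)) hX
    (PolyTime.filter (γ := Unit) (f := fun y : Unit × Customer => y.2.1)
      (PolyTime.fst.comp PolyTime.snd) (.const ()) hX)).fracSum

theorem PolyTime.better {M : δ → ℕ} {X Y : δ → List Customer} (hM : PolyTime M) (hX : PolyTime X)
    (hY : PolyTime Y) : PolyTime fun x => better (M x) (X x) (Y x) :=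
  ((hM.mul ((PolyTime.fst.comp hY.listRevenue).mul (PolyTime.snd.comp hX.listRevenue))).le
    ((hM.add (.const 1)).mul
      ((PolyTime.fst.comp hX.listRevenue).mul (PolyTime.snd.comp hY.listRevenue)))).not

theorem PolyTime.flips {X : δ → List Customer} (hX : PolyTime X) :
    PolyTime fun x => flips (X x) := by
  have h1 : PolyTime fun y : Customer × Customer => y.2.1 := PolyTime.fst.comp PolyTime.snd
  have h2 : PolyTime fun y : Customer × Customer =>
      (if decide (y.2.2.1 = y.1.2.1) then !y.2.1 else y.2.1, y.2.2) :=
    ((((PolyTime.fst.comp (PolyTime.snd.comp PolyTime.snd)).eq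
      (PolyTime.fst.comp (PolyTime.snd.comp PolyTime.fst))).ite h1.not h1).pair
      (PolyTime.snd.comp PolyTime.snd))
  exact hX.cons (PolyTime.map (γ := List Customer) (f := fun y : List Customer × Customer =>
    y.1.map fun z => (if decide (z.2.1 = y.2.2.1) then !z.1 else z.1, z.2))
    (h2.map PolyTime.snd PolyTime.fst) hX hX)

theorem PolyTime.neighbours (n : ℕ) {X : δ → List Customer} (hX : PolyTime X) :
    PolyTime fun x => neighbours n (X x) := by
  induction n with
  | zero => exact hX.cons (.const [])
  | succ n ih =>
    exact PolyTime.flatMap (γ := Unit) (f := fun y : Unit × List Customer => Pricing.flips y.2)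
      PolyTime.snd.flips (.const ()) ih

theorem polyTime_step (n c : ℕ) : PolyTime (step n c) := by
  have h1 : PolyTime fun y : (Caps × List Customer) × List Customer => y.1.1 :=
    PolyTime.fst.comp PolyTime.fst
  have h2 : PolyTime fun y : Caps × List Customer => candidates n c y.1 y.2 :=
    PolyTime.filter (γ := Caps × List Customer)
      (f := fun y : (Caps × List Customer) × List Customer =>
        (capsOk Customer.left y.1.1.1 y.2 && capsOk Customer.right y.1.1.2 y.2) &&
          better (stepParam c y.1.1) y.1.2 y.2)
      (((Customer.polyTime_left.capsOk (PolyTime.fst.comp h1) PolyTime.snd).and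
        (Customer.polyTime_right.capsOk (PolyTime.snd.comp h1) PolyTime.snd)).and
        (PolyTime.better (((PolyTime.const c).mul (PolyTime.fst.comp h1).length).add (.const 1))
          (PolyTime.snd.comp PolyTime.fst) PolyTime.snd))
      PolyTime.id (PolyTime.snd.neighbours n)
  refine (PolyTime.listCases ((PolyTime.const false).pair PolyTime.snd) ?_).comp
    (PolyTime.id.pair (h2.comp PolyTime.snd))
  exact (PolyTime.const true).pair ((PolyTime.fst.comp (PolyTime.snd.comp PolyTime.fst)).pair
    (PolyTime.fst.comp PolyTime.snd))

end

/-! #### Termination -/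

theorem map_snd_of_mem_flips {X Y : List Customer} (h : Y ∈ flips X) :
    Y.map Prod.snd = X.map Prod.snd := by
  rw [flips, List.mem_cons, List.mem_map] at h
  rcases h with rfl | ⟨y, -, rfl⟩
  · rfl
  · simp [Function.comp_def]

theorem map_snd_of_mem_neighbours {n : ℕ} {X Y : List Customer} (h : Y ∈ neighbours n X) :
    Y.map Prod.snd = X.map Prod.snd := by
  induction n generalizing Y with
  | zero => rw [neighbours, List.mem_singleton] at h; rw [h]
  | succ n ih =>
    rw [neighbours, List.mem_flatMap] at h
    obtain ⟨Z, hZ, h⟩ := h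
    rw [map_snd_of_mem_flips h, ih hZ]

/-- Only the status bits can differ, and a bit has size 1 or 2. This keeps the state small
throughout the search. -/
theorem esize_le_of_map_snd {X Y : List Customer} (h : Y.map Prod.snd = X.map Prod.snd) :
    esize Y ≤ 2 * esize X := by
  induction X generalizing Y with
  | nil => simp at h; rw [h]; omega
  | cons x X ih =>
    cases Y with
    | nil => simp at h
    | cons y Y =>
      rw [List.map_cons, List.map_cons, List.cons.injEq] at h
      have h1 := ih h.2
      have h2 : esize x = 1 + esize x.1 + esize x.2 := rfl
      have h3 : esize y = 1 + esize y.1 + esize y.2 := rfl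
      rw [h.1] at h3
      have h4 := esize_bool_le y.1
      rw [esize_cons, esize_cons]
      omega

theorem step_of_nil {n c : ℕ} {s : State} (h : candidates n c s.2.1 s.2.2 = []) :
    step n c s = (false, s.2) := by
  rw [step, h]; rfl

theorem step_of_ne_nil {n c : ℕ} {s : State} (h : candidates n c s.2.1 s.2.2 ≠ []) :
    ∃ Y ∈ candidates n c s.2.1 s.2.2, step n c s = (true, s.2.1, Y) := by
  obtain ⟨Y, l, hl⟩ := List.exists_cons_of_ne_nil h
  refine ⟨Y, by rw [hl]; simp, ?_⟩
  rw [step, hl]; rfl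

/-- What a step does. -/
theorem step_cases (n c : ℕ) (s : State) :
    (candidates n c s.2.1 s.2.2 = [] ∧ step n c s = (false, s.2)) ∨
      ∃ Y ∈ candidates n c s.2.1 s.2.2, step n c s = (true, s.2.1, Y) := by
  by_cases h : candidates n c s.2.1 s.2.2 = []
  · exact Or.inl ⟨h, step_of_nil h⟩
  · exact Or.inr (step_of_ne_nil h)

theorem step_iterate_caps (n c i : ℕ) (s : State) : ((step n c)^[i] s).2.1 = s.2.1 := by
  induction i with
  | zero => rfl
  | succ i ih =>
    rw [Function.iterate_succ_apply']
    rcases step_cases n c ((step n c)^[i] s) with ⟨-, h⟩ | ⟨Y, -, h⟩ <;> rw [h] <;> exact ih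

theorem step_iterate_map_snd (n c i : ℕ) (s : State) :
    ((step n c)^[i] s).2.2.map Prod.snd = s.2.2.map Prod.snd := by
  induction i with
  | zero => rfl
  | succ i ih =>
    rw [Function.iterate_succ_apply', ← ih]
    rcases step_cases n c ((step n c)^[i] s) with ⟨-, h⟩ | ⟨Y, hY, h⟩ <;> rw [h]
    exact map_snd_of_mem_neighbours (List.mem_filter.1 hY).1

theorem esize_step_iterate_le (n c i : ℕ) (s : State) :
    esize ((step n c)^[i] s) ≤ 3 * esize s := by
  have h1 := esize_le_of_map_snd (step_iterate_map_snd n c i s)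
  have h2 : ∀ s : State, esize s = 1 + esize s.1 + (1 + esize s.2.1 + esize s.2.2) := fun _ => rfl
  have h3 := esize_bool_le ((step n c)^[i] s).1
  rw [h2, h2 s, step_iterate_caps]
  omega

/-- The revenue of a list of customers. -/
def ratRevenue (X : List Customer) : ℚ≥0 := ((X.filter fun r => r.1).map fun r =>
  itemPrice X r.left).sum

theorem listRevenue_spec (X : List Customer) : (listRevenue X).2 ≠ 0 ∧
    ((listRevenue X).1 : ℚ≥0) / (listRevenue X).2 = ratRevenue X := fracSum_spec _

theorem better_iff (M : ℕ) (X Y : List Customer) :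
    better M X Y = true ↔ (M + 1) * ratRevenue X < M * ratRevenue Y := by
  obtain ⟨hX, hX'⟩ := listRevenue_spec X
  obtain ⟨hY, hY'⟩ := listRevenue_spec Y
  have h1 : (0 : ℚ≥0) < (listRevenue X).2 := Nat.cast_pos.2 (Nat.pos_of_ne_zero hX)
  have h2 : (0 : ℚ≥0) < (listRevenue Y).2 := Nat.cast_pos.2 (Nat.pos_of_ne_zero hY)
  rw [better, ← hX', ← hY', Bool.not_eq_true', decide_eq_false_iff_not, not_le, ← mul_div_assoc,
    ← mul_div_assoc, div_lt_div_iff₀ h1 h2, ← Nat.cast_lt (α := ℚ≥0)]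
  push_cast
  rw [mul_assoc, mul_assoc]

/-- Numerator and denominator are at most `2 ^ K`, so nonzero revenues range over a factor of `4 ^
K`; this caps the number of doublings. -/
theorem ratRevenue_bounds {X : List Customer} {K : ℕ} (hK : esize (listRevenue X) ≤ K) :
    ratRevenue X ≤ 2 ^ K ∧ (ratRevenue X ≠ 0 → 1 ≤ 2 ^ K * ratRevenue X) := by
  obtain ⟨hX, hX'⟩ := listRevenue_spec X
  rw [← hX']
  set x := listRevenue X
  have h1 : (0 : ℚ≥0) < x.2 := Nat.cast_pos.2 (Nat.pos_of_ne_zero hX)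
  have h2 : esize x = 1 + esize x.1 + esize x.2 := rfl
  have h3 : ∀ n : ℕ, esize n ≤ K → (n : ℚ≥0) ≤ 2 ^ K := fun n hn => by
    have := (lt_two_pow_esize n).le.trans (Nat.pow_le_pow_right two_pos hn)
    exact_mod_cast this
  constructor
  · refine (div_le_self (by positivity) ?_).trans (h3 x.1 (by omega))
    exact_mod_cast Nat.one_le_iff_ne_zero.2 hX
  · intro h0
    have h4 : (1 : ℚ≥0) ≤ x.1 := by
      have : x.1 ≠ 0 := fun h => h0 (by rw [h]; simp)
      exact_mod_cast Nat.one_le_iff_ne_zero.2 this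
    rw [← mul_div_assoc, le_div_iff₀ h1, one_mul]
    calc (x.2 : ℚ≥0) ≤ 2 ^ K := h3 x.2 (by omega)
      _ = 2 ^ K * 1 := (mul_one _).symm
      _ ≤ _ := by gcongr

/-- By Bernoulli (1 + 1/M)^M ≥ 2, so `M` steps double the value. Counting begins at index 1 because
the initial revenue may be zero. -/
theorem geometric_growth {M : ℕ} (hM : 0 < M) {r : ℕ → ℚ≥0} {N : ℕ}
    (h : ∀ i < N, (M + 1) * r i < M * r (i + 1)) (t : ℕ) (ht : M * t < N) :
    2 ^ t * r 1 ≤ r (M * t + 1) := by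
  have hM' : (0 : ℚ≥0) < M := Nat.cast_pos.2 hM
  have h1 : ∀ j i, i + j < N + 1 → (1 + 1 / M : ℚ≥0) ^ j * r i ≤ r (i + j) := by
    intro j
    induction j with
    | zero => intro i _; simp
    | succ j ih =>
      intro i hi
      have h2 := (h (i + j) (by omega)).le
      have h3 := ih i (by omega)
      have h4 : (1 + 1 / M : ℚ≥0) * r (i + j) ≤ r (i + j + 1) := by
        rw [← mul_le_mul_iff_right₀ hM', ← mul_assoc, mul_add, mul_one_div_cancel hM'.ne', mul_one]
        exact h2
      rw [pow_succ', mul_assoc]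
      exact (mul_le_mul_right h3 _).trans h4
  have h2 : (2 : ℚ≥0) ≤ (1 + 1 / M : ℚ≥0) ^ M := by
    have h3 := one_add_mul_le_pow (a := (1 / M : ℚ)) (by
      have : (0 : ℚ) ≤ 1 / M := by positivity
      linarith) M
    rw [mul_one_div_cancel (by exact_mod_cast hM.ne')] at h3
    have h4 : (((2 : ℚ≥0)) : ℚ) ≤ (((1 + 1 / M : ℚ≥0) ^ M : ℚ≥0) : ℚ) := by
      push_cast
      linarith
    exact_mod_cast h4
  calc 2 ^ t * r 1 ≤ ((1 + 1 / M : ℚ≥0) ^ M) ^ t * r 1 := by gcongr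
    _ = (1 + 1 / M : ℚ≥0) ^ (M * t) * r 1 := by rw [pow_mul]
    _ ≤ _ := by rw [add_comm (M * t)]; exact h1 _ _ (by omega)

theorem exists_iterate_stops (n c : ℕ) {T : Polynomial ℕ}
    (hT : ∀ X, esize (listRevenue X) ≤ T.eval (esize X)) (s : State) :
    ∃ i ≤ stepParam c s.2.1 * (2 * T.eval (2 * esize s) + 1) + 2, ((step n c)^[i] s).1 = false := by
  by_contra! hcon
  set K := T.eval (2 * esize s)
  set M := stepParam c s.2.1
  set r : ℕ → ℚ≥0 := fun i => ratRevenue ((step n c)^[i] s).2.2 with hr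
  have hK : ∀ i, esize (listRevenue ((step n c)^[i] s).2.2) ≤ K := fun i =>
    (hT _).trans (eval_mono T ((esize_le_of_map_snd (step_iterate_map_snd n c i s)).trans (by
      have h2 : esize s = 1 + esize s.1 + (1 + esize s.2.1 + esize s.2.2) := rfl
      omega)))
  have h : ∀ i < M * (2 * K + 1) + 2, (M + 1) * r i < M * r (i + 1) := by
    intro i hi
    have h1 := hcon (i + 1) (by omega)
    simp only [hr]
    rw [Function.iterate_succ_apply'] at h1 ⊢
    rcases step_cases n c ((step n c)^[i] s) with ⟨-, h⟩ | ⟨Y, hY, h⟩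
    · rw [h] at h1; exact absurd rfl h1
    · rw [h]
      have h2 := (Bool.and_eq_true_iff.1 (List.mem_filter.1 hY).2).2
      rw [better_iff, step_iterate_caps] at h2
      exact h2
  -- After the first step the revenue is at least `2 ^ (-K)`, so `2 * K + 1` doublings push it above
  -- `2 ^ K`.
  have h1 := geometric_growth (Nat.succ_pos _) h (2 * K + 1) (by
    change M * _ < _; omega)
  have h2 : r 1 ≠ 0 := by
    intro h0
    have := h 0 (by omega)
    rw [zero_add, h0, mul_zero] at this
    exact absurd this not_lt_zero
  have h3 := (ratRevenue_bounds (hK 1)).2 h2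
  have h4 := (ratRevenue_bounds (hK (M * (2 * K + 1) + 1))).1
  have h5 : (2 : ℚ≥0) ^ (K + 1) ≤ 2 ^ K := by
    calc (2 : ℚ≥0) ^ (K + 1) = 2 ^ (K + 1) * 1 := (mul_one _).symm
      _ ≤ 2 ^ (K + 1) * (2 ^ K * r 1) := by gcongr
      _ = 2 ^ (2 * K + 1) * r 1 := by rw [← mul_assoc, ← pow_add]; congr 2; omega
      _ ≤ _ := h1.trans h4
  rw [pow_succ] at h5
  have h6 : (0 : ℚ≥0) < 2 ^ K := by positivity
  have h7 : (2 : ℚ≥0) ^ K < 2 ^ K * 2 := lt_mul_of_one_lt_right h6 one_lt_two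
  exact absurd h5 (not_le.2 h7)

theorem exists_stops (n c : ℕ) (s : State) : ∃ i, ((step n c)^[i] s).1 = false := by
  obtain ⟨T, hT⟩ := (PolyTime.listRevenue PolyTime.id).bdd
  obtain ⟨i, -, h⟩ := exists_iterate_stops n c hT s
  exact ⟨i, h⟩

/-- The local search. -/
def search (n c : ℕ) (s : State) : State := (step n c)^[Nat.find (exists_stops n c s)] s

theorem polyTime_search (n c : ℕ) : PolyTime (search n c) := by
  obtain ⟨T, hT⟩ := (PolyTime.listRevenue PolyTime.id).bdd
  refine PolyTime.loop (c := fun s : State => s.1) PolyTime.fst (polyTime_step n c)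
    (n := fun s => Nat.find (exists_stops n c s))
    (S := fun s => 3 * esize s)
    (((((PolyBdd.const c).mul PolyBdd.size).add (.const 1)).mul
      (((PolyBdd.const 2).mul (((PolyBdd.const 2).mul PolyBdd.size).eval T)).add (.const 1))).add
        (.const 2) |>.mono fun s => ?_)
    ((PolyBdd.const 3).mul PolyBdd.size) (fun s i _ => esize_step_iterate_le n c i s)
    (fun s i hi => by simpa using Nat.find_min (exists_stops n c s) hi)
    (fun s => Nat.find_spec (exists_stops n c s))
  obtain ⟨i, hi, h⟩ := exists_iterate_stops n c hT s
  refine (Nat.find_min' _ h).trans (hi.trans ?_)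
  have h1 := length_le_esize s.2.1.1
  have h2 : esize s = 1 + esize s.1 + (1 + (1 + esize s.2.1.1 + esize s.2.1.2) + esize s.2.2) := rfl
  have h3 : stepParam c s.2.1 ≤ c * esize s + 1 :=
    Nat.add_le_add_right (Nat.mul_le_mul_left _ (by omega)) _
  exact Nat.add_le_add_right (Nat.mul_le_mul_right _ h3) _

/-- At the end of the search there are no candidates, and the solution respects the capacities
unless it is the initial one. -/
theorem search_spec (n c : ℕ) (cs : Caps) (X : List Customer) :
    ∃ Y, search n c (true, cs, X) = (false, cs, Y) ∧ candidates n c cs Y = [] ∧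
      Y.map Prod.snd = X.map Prod.snd ∧
      (Y = X ∨ (capsOk Customer.left cs.1 Y && capsOk Customer.right cs.2 Y) = true) := by
  set s : State := (true, cs, X)
  have key : ∀ i, ((step n c)^[i] s).2.2 = X ∨ (capsOk Customer.left cs.1 ((step n c)^[i] s).2.2 &&
      capsOk Customer.right cs.2 ((step n c)^[i] s).2.2) = true := by
    intro i
    induction i with
    | zero => exact Or.inl rfl
    | succ i ih =>
      rw [Function.iterate_succ_apply']
      rcases step_cases n c ((step n c)^[i] s) with ⟨-, h⟩ | ⟨Y, hY, h⟩
      · rw [h]; exact ih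
      · rw [h]
        have h2 := (Bool.and_eq_true_iff.1 (List.mem_filter.1 hY).2).1
        rw [step_iterate_caps] at h2
        exact Or.inr h2
  have hspec : (search n c s).1 = false := Nat.find_spec (exists_stops n c s)
  refine ⟨(search n c s).2.2, ?_, ?_, step_iterate_map_snd n c _ s, key _⟩
  · refine Prod.ext hspec (Prod.ext (step_iterate_caps n c _ s) rfl)
  · rw [search] at hspec ⊢
    -- The initial flag is `true`, so at least one step is made; the last one cleared the flag and
    -- hence found no candidates.
    cases hj : Nat.find (exists_stops n c s) with
    | zero =>
      rw [hj] at hspec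
      exact absurd hspec (by simp [s])
    | succ j =>
      rw [hj, Function.iterate_succ_apply'] at hspec
      rw [Function.iterate_succ_apply']
      have h1 := step_iterate_caps n c j s
      rcases step_cases n c ((step n c)^[j] s) with ⟨h0, h⟩ | ⟨Y, hY, h⟩
      · rw [h]
        rw [h1] at h0
        exact h0
      · rw [h] at hspec; exact absurd hspec (by simp)

/-! ### The algorithm on instances -/

/-- An instance as lists. -/
abbrev ListInstance := List ℕ × List ℕ × List ((ℕ × ℕ) × ℚ≥0)

/-- Local search from the empty solution, and its output as lists. -/
def solve (n c : ℕ) (x : ListInstance) : List ℚ≥0 × List Bool :=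
  (fun s : State => (s.2.1.1.map fun y => itemPrice s.2.2 y.2, s.2.2.map fun y => y.1))
    (search n c (true, (x.1.zipIdx, x.2.1.zipIdx), x.2.2.zipIdx.map fun y => (false, y.2, y.1)))

theorem polyTime_solve (n c : ℕ) : PolyTime (solve n c) := by
  have h1 : PolyTime fun s : State => (s.2.1.1.map fun y => itemPrice s.2.2 y.2) :=
    PolyTime.map (γ := List Customer) (f := fun y : List Customer × ℕ × ℕ => itemPrice y.1 y.2.2)
      (PolyTime.fst.itemPrice (PolyTime.snd.comp PolyTime.snd)) (PolyTime.snd.comp PolyTime.snd)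
      (PolyTime.fst.comp (PolyTime.fst.comp PolyTime.snd))
  have h2 : PolyTime fun s : State => s.2.2.map fun y => y.1 :=
    PolyTime.map (γ := Unit) (f := fun y : Unit × Customer => y.2.1)
      (PolyTime.fst.comp PolyTime.snd) (.const ()) (PolyTime.snd.comp PolyTime.snd)
  have h3 : PolyTime fun x : ListInstance =>
      x.2.2.zipIdx.map fun y : ((ℕ × ℕ) × ℚ≥0) × ℕ => ((false, y.2, y.1) : Customer) :=
    PolyTime.map (γ := Unit)
      (f := fun y : Unit × ((ℕ × ℕ) × ℚ≥0) × ℕ => ((false, y.2.2, y.2.1) : Customer))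
      ((PolyTime.const false).pair ((PolyTime.snd.comp PolyTime.snd).pair
        (PolyTime.fst.comp PolyTime.snd))) (.const ())
      (PolyTime.zipIdx (PolyTime.snd.comp PolyTime.snd))
  exact (h1.pair h2).comp ((polyTime_search n c).comp ((PolyTime.const true).pair
    (((PolyTime.zipIdx PolyTime.fst).pair
      (PolyTime.zipIdx (PolyTime.fst.comp PolyTime.snd))).pair h3)))

/-! ### Correspondence between the list routines and finite sets of edges -/

theorem zipIdx_ofFn {α : Type*} {n : ℕ} (f : Fin n → α) :
    (List.ofFn f).zipIdx = (List.finRange n).map fun i => (f i, (i : ℕ)) := by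
  apply List.ext_getElem <;> simp

theorem length_filter_finRange {m : ℕ} (p : Fin m → Bool) :
    ((List.finRange m).filter p).length = (Finset.univ.filter fun i => p i = true).card := by
  rw [← List.toFinset_card_of_nodup ((List.nodup_finRange m).filter _)]
  congr 1
  ext; simp

theorem listMin_mem {l : List ℚ≥0} (h : l ≠ []) : listMin l ∈ l := by
  cases l with
  | nil => exact absurd rfl h
  | cons b l => exact foldl_min_mem l b

theorem foldl_min_le (l : List ℚ≥0) (b : ℚ≥0) : ∀ q ∈ b :: l, l.foldl min b ≤ q := by
  induction l generalizing b with
  | nil => simp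
  | cons a l ih =>
    intro q hq
    have h := ih (min b a)
    rw [List.foldl_cons]
    rcases List.mem_cons.1 hq with rfl | hq
    · exact (h _ List.mem_cons_self).trans (min_le_left _ _)
    · rcases List.mem_cons.1 hq with rfl | hq
      · exact (h _ List.mem_cons_self).trans (min_le_right _ _)
      · exact h q (List.mem_cons_of_mem _ hq)

theorem listMin_le {l : List ℚ≥0} {q : ℚ≥0} (h : q ∈ l) : listMin l ≤ q := by
  cases l with
  | nil => simp at h
  | cons b l => exact foldl_min_le l b q h

/-- The code of a capacity. -/
noncomputable def capCode (c : ℕ∞) : ℕ := if c = ⊤ then 0 else c.toNat + 1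

theorem le_iff_capCode (n : ℕ) (c : ℕ∞) : (n : ℕ∞) ≤ c ↔ capCode c = 0 ∨ n + 1 ≤ capCode c := by
  induction c using ENat.recTopCoe with
  | top => simp [capCode]
  | coe c => simp [capCode]

namespace Instance

variable {l r m : ℕ} (I : Instance ℚ≥0 (Fin l) (Fin r) (Fin m))

/-- A customer as an entry of the list. -/
def customer (F : Finset (Fin m)) (e : Fin m) : Customer :=
  (decide (e ∈ F), e, (I.left e, I.right e), I.budget e)

/-- The customers as a list. -/
def customers (F : Finset (Fin m)) : List Customer := (List.finRange m).map (I.customer F)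

/-- The instance as lists. -/
noncomputable def toLists : ListInstance :=
  (List.ofFn fun u => capCode (I.capL u), List.ofFn fun v => capCode (I.capR v),
    List.ofFn fun e => (((I.left e : ℕ), (I.right e : ℕ)), I.budget e))

/-- The lists that the algorithm reads have the prescribed encoding of the instance, so no
conversion program is needed. -/
theorem enc_toLists : Enc.enc I.toLists = I.encode := by
  simp only [Enc.enc, toLists, List.map_ofFn]
  rfl

theorem served_customers (side : Customer → ℕ) (F : Finset (Fin m)) (u : ℕ) :
    served side (I.customers F) u = ((List.finRange m).filter fun e =>
      decide (e ∈ F) && decide (side (I.customer F e) = u)).map (I.customer F) := by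
  rw [served, customers, List.filter_map]
  rfl

theorem length_served_customers (side : Customer → ℕ) (F : Finset (Fin m)) (u : ℕ) :
    (served side (I.customers F) u).length =
      (F.filter fun e => side (I.customer F e) = u).card := by
  rw [served_customers, List.length_map, length_filter_finRange]
  congr 1
  ext; simp

theorem capsOk_customers {n : ℕ} (side : Customer → ℕ) (side' : Fin m → Fin n) (cap : Fin n → ℕ∞)
    (F : Finset (Fin m)) (h : ∀ e, side (I.customer F e) = side' e) :
    capsOk side (List.ofFn fun u => capCode (cap u)).zipIdx (I.customers F) = true ↔
      ∀ u, ((F.filter fun e => side' e = u).card : ℕ∞) ≤ cap u := by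
  rw [zipIdx_ofFn, capsOk, List.isEmpty_iff, List.filter_eq_nil_iff]
  simp only [List.mem_map, List.mem_finRange, true_and, forall_exists_index,
    forall_apply_eq_imp_iff]
  refine forall_congr' fun u => ?_
  rw [length_served_customers, le_iff_capCode]
  simp only [h, Fin.val_inj]
  simp only [Bool.not_eq_true', Bool.not_eq_false, Bool.or_eq_true, decide_eq_true_eq]

theorem itemPrice_customers (F : Finset (Fin m)) (u : Fin l) :
    ((itemPrice (I.customers F) u : ℚ≥0) : ℝ≥0) = I.toReal.minPrice F u := by
  have hmem : ∀ q, q ∈ ((served Customer.left (I.customers F) u).map fun r => r.2.2.2) ↔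
      ∃ e ∈ F, I.left e = u ∧ I.budget e = q := by
    intro q
    rw [served_customers]
    simp [customer, Customer.left, and_assoc, Fin.val_inj]
  rw [itemPrice]
  by_cases h : ∃ e ∈ F, I.left e = u
  · obtain ⟨e, he, rfl⟩ := h
    obtain ⟨f, hf, hf', hf''⟩ := I.toReal.exists_minPrice_eq he
    obtain ⟨g, hg, hg', hg''⟩ := (hmem _).1 (listMin_mem (List.ne_nil_of_mem
        ((hmem _).2 ⟨e, he, rfl, rfl⟩)))
    refine le_antisymm ?_ ?_
    · refine le_of_le_of_eq ?_ hf''.symm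
      exact NNRat.cast_le.2 (listMin_le ((hmem _).2 ⟨f, hf, hf', rfl⟩))
    · rw [← hg'', ← hg']
      exact I.toReal.minPrice_le hg
  · push Not at h
    have hnil : ((served Customer.left (I.customers F) u).map fun r => r.2.2.2) = [] := by
      refine List.eq_nil_iff_forall_not_mem.2 fun q hq => ?_
      obtain ⟨e, he, he', -⟩ := (hmem q).1 hq
      exact h e he he'
    rw [I.toReal.minPrice_eq_zero h, hnil]
    simp [listMin]

theorem ratRevenue_customers (F : Finset (Fin m)) :
    ((ratRevenue (I.customers F) : ℚ≥0) : ℝ≥0) = I.toReal.revenue (I.toReal.minPrice F) F := by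
  have h1 : ratRevenue (I.customers F) = ∑ e ∈ F, itemPrice (I.customers F) (I.left e) := by
    rw [ratRevenue]
    nth_rewrite 2 [customers]
    rw [List.filter_map, List.map_map, ← List.sum_toFinset _ ((List.nodup_finRange m).filter _)]
    refine Finset.sum_congr ?_ fun e _ => rfl
    ext; simp [customer]
  rw [h1, NNRat.cast_sum, revenue]
  exact Finset.sum_congr rfl fun e _ => I.itemPrice_customers F _

theorem customers_symmDiff_mem_flips (F : Finset (Fin m)) (e : Fin m) :
    I.customers (symmDiff F {e}) ∈ flips (I.customers F) := by
  rw [flips, List.mem_cons, List.mem_map]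
  refine Or.inr ⟨I.customer F e, by simp [customers], ?_⟩
  rw [customers, customers, List.map_map]
  refine List.map_congr_left fun z _ => ?_
  simp only [Function.comp_apply, customer, Finset.mem_symmDiff, Finset.mem_singleton,
    decide_eq_true_eq, Fin.val_inj, Prod.mk.injEq, and_true]
  by_cases h : z = e <;> by_cases h' : z ∈ F <;> simp [h, h']

/-- Flipping one element of the symmetric difference in `F'` brings it closer to `F`; flipping it
back is the last move. -/
theorem customers_mem_neighbours {n : ℕ} {F F' : Finset (Fin m)} (h : (symmDiff F F').card ≤ n) :
    I.customers F' ∈ neighbours n (I.customers F) := by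
  induction n generalizing F' with
  | zero =>
    have : F = F' := by
      rwa [Nat.le_zero, Finset.card_eq_zero, ← Finset.bot_eq_empty, symmDiff_eq_bot] at h
    simp [neighbours, this]
  | succ n ih =>
    rw [neighbours, List.mem_flatMap]
    by_cases hF : F = F'
    · exact ⟨I.customers F', ih (by simp [hF]), by simp [flips]⟩
    · obtain ⟨e, he⟩ : (symmDiff F F').Nonempty := by
        rw [Finset.nonempty_iff_ne_empty, ← Finset.bot_eq_empty, Ne, symmDiff_eq_bot]
        exact hF
      refine ⟨I.customers (symmDiff F' {e}), ih ?_, ?_⟩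
      · rw [← symmDiff_assoc]
        have h1 : symmDiff (symmDiff F F') {e} = (symmDiff F F').erase e := by
          ext z
          rw [Finset.mem_symmDiff, Finset.mem_erase, Finset.mem_singleton]
          by_cases hz : z = e
          · subst hz; tauto
          · tauto
        rw [h1, Finset.card_erase_of_mem he]
        omega
      · have := I.customers_symmDiff_mem_flips (symmDiff F' {e}) e
        rwa [symmDiff_assoc, symmDiff_self, symmDiff_bot] at this

/-- The search never alters anything but status bits, and these define the set `F'`. -/
theorem exists_eq_customers {X : List Customer} {F : Finset (Fin m)}
    (h : X.map Prod.snd = (I.customers F).map Prod.snd) : ∃ F', X = I.customers F' := by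
  have hlen : X.length = m := by
    have := congrArg List.length h
    simpa [customers] using this
  refine ⟨Finset.univ.filter fun e : Fin m => (X[e.val]'(by rw [hlen]; exact e.2)).1 = true, ?_⟩
  refine List.ext_getElem (by simp [customers, hlen]) fun i hi hi' => Prod.ext ?_ ?_
  · simp [customers, customer]
  · have h1 : (X.map Prod.snd)[i]'(by simpa using hi) =
        ((I.customers F).map Prod.snd)[i]'(by simpa [customers] using hi') := by
      simp only [h]
    simpa [customers, customer] using h1

/-- What the algorithm computes. -/
theorem solve_spec (n c : ℕ) : ∃ F : Finset (Fin m),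
    Enc.enc (solve n c I.toLists) =
      encodeSolution (fun u : Fin l => itemPrice (I.customers F) u) F ∧
    I.toReal.Feasible (I.toReal.minPrice F) F ∧
    ∀ F' : Finset (Fin m), I.toReal.Feasible (I.toReal.minPrice F') F' →
      (symmDiff F F').card ≤ n →
      ((c * l + 1 : ℕ) : ℝ) * I.toReal.revenue (I.toReal.minPrice F') F' ≤
        (((c * l + 1 : ℕ) : ℝ) + 1) * I.toReal.revenue (I.toReal.minPrice F) F := by
  classical
  have hok : ∀ F : Finset (Fin m), (capsOk Customer.left I.toLists.1.zipIdx (I.customers F) &&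
      capsOk Customer.right I.toLists.2.1.zipIdx (I.customers F)) = true ↔
      I.toReal.Feasible (I.toReal.minPrice F) F := by
    intro F
    rw [Bool.and_eq_true_iff, toLists,
      I.capsOk_customers Customer.left I.left I.capL F fun _ => rfl,
      I.capsOk_customers Customer.right I.right I.capR F fun _ => rfl]
    constructor
    · rintro ⟨h1, h2⟩
      exact ⟨fun _ he => I.toReal.minPrice_le he, fun u => by convert h1 u <;> rfl,
        fun v => by convert h2 v <;> rfl⟩
    · intro h
      exact ⟨fun u => by convert h.supplyL u <;> rfl, fun v => by convert h.supplyR v <;> rfl⟩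
  have hstart : (I.toLists.2.2.zipIdx.map fun y => ((false, y.2, y.1) : Customer)) =
      I.customers ∅ := by
    rw [toLists, zipIdx_ofFn, List.map_map, customers]
    refine List.map_congr_left fun e _ => ?_
    simp [customer]
  obtain ⟨Y, h1, h2, h3, h4⟩ :=
    search_spec n c (I.toLists.1.zipIdx, I.toLists.2.1.zipIdx) (I.customers ∅)
  obtain ⟨F, rfl⟩ := I.exists_eq_customers h3
  refine ⟨F, ?_, ?_, fun F' hF' hd => ?_⟩
  · rw [solve, hstart, h1]
    simp only [toLists, zipIdx_ofFn, customers, List.map_map, encodeSolution, Enc.enc]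
    simp only [List.ofFn_eq_map]
    congr 2
    refine List.map_congr_left fun e _ => ?_
    simp [customer]
  -- Either nothing was ever accepted and the solution is the empty set, feasible for all
  -- capacities, or the capacities were checked on acceptance.
  · rcases h4 with h4 | h4
    · exact (hok F).1 (by rw [h4]; exact (hok ∅).2 (I.toReal.feasible_empty _))
    · exact (hok F).1 h4
  · have h5 : better (c * l + 1) (I.customers F) (I.customers F') ≠ true := by
      intro hb
      have h6 : I.customers F' ∈ candidates n c (I.toLists.1.zipIdx, I.toLists.2.1.zipIdx)
          (I.customers F) := by
        refine List.mem_filter.2 ⟨I.customers_mem_neighbours hd, ?_⟩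
        rw [Bool.and_eq_true_iff]
        refine ⟨(hok F').2 hF', ?_⟩
        simpa [stepParam, toLists] using hb
      rw [h2] at h6
      simp at h6
    rw [Ne, better_iff, not_lt] at h5
    have h6 : ((((c * l + 1 : ℕ) : ℚ≥0) * ratRevenue (I.customers F') : ℚ≥0) : ℝ≥0) ≤
        (((((c * l + 1 : ℕ) : ℚ≥0) + 1) * ratRevenue (I.customers F) : ℚ≥0) : ℝ≥0) :=
      NNRat.cast_le.2 h5
    rw [NNRat.cast_mul, NNRat.cast_mul, NNRat.cast_add, NNRat.cast_natCast, NNRat.cast_one,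
      ratRevenue_customers, ratRevenue_customers] at h6
    exact_mod_cast h6

end Instance

/-! ### Choice of the constants -/

theorem tendsto_gap {C : ℝ} (hC : 2 ≤ C) :
    Filter.Tendsto (fun d : ℕ => (2 * C - 1 - C ^ (-(d : ℤ))) / (C - C ^ (-(d : ℤ))))
      Filter.atTop (nhds ((2 * C - 1) / C)) := by
  have h : Filter.Tendsto (fun d : ℕ => C ^ (-(d : ℤ))) Filter.atTop (nhds 0) := by
    have := tendsto_pow_atTop_nhds_zero_of_lt_one (r := C⁻¹) (by positivity)
      (inv_lt_one_of_one_lt₀ (by linarith))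
    refine this.congr fun d => ?_
    rw [zpow_neg, zpow_natCast, inv_pow]
  have h' := (h.const_sub (2 * C - 1)).div (h.const_sub C) (by rw [sub_zero]; linarith)
  rw [sub_zero, sub_zero] at h'
  exact h'

theorem hasPolyTimeApprox {C ε : ℝ} (hC : 2 ≤ C) (hε : 0 < ε) :
    HasPolyTimeApprox C ((2 * C - 1) / C + ε) := by
  have hk : (⌊C⌋₊ : ℝ) ≤ C := Nat.floor_le (by linarith)
  -- One half of `ε` pays for the finite depth `d`, the other for ignoring small improvements.
  obtain ⟨d, hd⟩ : ∃ d : ℕ, (2 * C - 1 - C ^ (-(d : ℤ))) / (C - C ^ (-(d : ℤ))) <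
      (2 * C - 1) / C + ε / 2 :=
    ((tendsto_gap hC).eventually_lt_const (by linarith)).exists
  obtain ⟨c, hc⟩ := exists_nat_ge (2 / ε)
  obtain ⟨P, t, ⟨T, hT⟩, hP⟩ := polyTime_solve
    (3 * (⌊C⌋₊ * ∑ j ∈ Finset.range (d + 1), ⌊C⌋₊ ^ j)) c
  refine ⟨P, T, fun l r m I hI => ?_⟩
  obtain ⟨F, hF1, hF2, hF3⟩ := I.solve_spec
    (3 * (⌊C⌋₊ * ∑ j ∈ Finset.range (d + 1), ⌊C⌋₊ ^ j)) c
  obtain ⟨s, hs, hr⟩ := hP I.toLists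
  have hp : (fun u : Fin l => ((itemPrice (I.customers F) u : ℚ≥0) : ℝ≥0)) =
      I.toReal.minPrice F := funext fun u => I.itemPrice_customers F u
  rw [hF1, I.enc_toLists] at hr
  refine ⟨_, F, s, hr, hs.trans ((hT _).trans_eq ?_), ?_, fun q G hG => ?_⟩
  · rw [esize, I.enc_toLists]
  · rw [hp]; exact hF2
  rw [hp]
  set v := I.toReal.revenue (I.toReal.minPrice F) F
  have hM : (0 : ℝ) < ((c * l + 1 : ℕ) : ℝ) := by positivity
  -- With M = c · l + 1, a rejected neighbour has revenue at most (1 + 1/M)v, hence the slack v/M.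
  -- Passing from the mixed prices to `minPrice` on `F'` can only raise the revenue.
  have key := I.toReal.revenue_le_of_swaps (d := d) rfl
    (Instance.capL_le_floor (I := I.toReal) hI (by linarith)) hF2 hG
    ((v : ℝ) / ((c * l + 1 : ℕ) : ℝ)) (fun S F' _ hF' hcard => by
      have h1 := NNReal.coe_le_coe.2 hF'.revenue_le
      have h2 := hF3 F' hF'.minPrice (by convert hcard)
      refine h1.trans ?_
      rw [← sub_le_iff_le_add', le_div_iff₀ hM]
      linarith)
  rw [Fintype.card_fin] at key
  push_cast at key hM
  have h2 := geom_sum_pos_of_nonneg (Nat.cast_nonneg ⌊C⌋₊) d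
  have h3 := pow_le_geom_sum_mul (Nat.cast_nonneg ⌊C⌋₊) hk d
  rw [gap_eq hC] at hd
  have hv : (0 : ℝ) ≤ v := NNReal.coe_nonneg _
  -- The choice c ≥ 2/ε makes l / (c · l + 1) at most ε/2, uniformly in `l`.
  have h4 : (l : ℝ) * ((v : ℝ) / (c * l + 1)) ≤ ε / 2 * v := by
    rw [← mul_div_assoc, div_le_iff₀ hM]
    have h5 : 1 ≤ ε / 2 * c := by
      rw [div_le_iff₀ hε] at hc
      linarith
    have h6 : (l : ℝ) ≤ ε / 2 * (c * l + 1) := by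
      nlinarith [mul_le_mul_of_nonneg_right h5 (Nat.cast_nonneg (α := ℝ) l)]
    nlinarith [mul_le_mul_of_nonneg_right h6 hv]
  refine le_of_mul_le_mul_left ?_ h2
  have h5 := mul_le_mul_of_nonneg_left h4 h2.le
  have h6 := mul_le_mul_of_nonneg_right h3 hv
  have h7 := mul_le_mul_of_nonneg_left (mul_le_mul_of_nonneg_right hd.le hv) h2.le
  nlinarith

end Pricing

theorem mainTheorem2 :
    (∀ (L R E : Type*) [Fintype L] [Fintype R] [Fintype E] (I : Pricing.Instance ℝ≥0 L R E)
      (C : ℝ) (d : ℕ), 2 ≤ C → I.CapBoundedBy C →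
        I.LocalityGapAtMost ((C ^ (d + 1) - 1) / (C - 1))
          ((2 * C - 1 - C ^ (-(d : ℤ))) / (C - C ^ (-(d : ℤ))))) ∧
    (∀ C ε : ℝ, 2 ≤ C → 0 < ε → Pricing.HasPolyTimeApprox C ((2 * C - 1) / C + ε)) := by
  exact ⟨fun L R E _ _ _ I C d hC hI => I.localityGapAtMost d hC hI,
    fun C ε hC hε => Pricing.hasPolyTimeApprox hC hε⟩
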